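/- Consider an M/GI/1/1 system: packets arrive according to a Poisson process of rate $\lambda>0$ (the inter-arrival times are i.i.d. $\mathrm{Exp}(\lambda)$) at a single server without waiting room, which is empty at time $0$. A packet that finds the server idle is served at once and without preemption, and a packet that finds it busy is discarded. The served packets are numbered $0,1,2,\dots$. Their service times $X_0,X_1,\dots\ge 0$ are i.i.d., independent of the arrivals, with $0<\mathbb{E}[X_0]=\frac1\mu<\infty$. Let $T_A(k)$ and $T_D(k)=T_A(k)+X_k$ be the arrival and departure instants of the served packet $k$. Let $\Delta(t)=t-\max\{T_A(n):T_D(n)\le t\}$ be the age of information at time $t$ (with $\Delta(t)=t$ before the first departure). For $k\ge1$ let $I_k=T_A(k)-T_D(k-1)$ be the idle time of the server before packet $k$ and let $\nu=1/\mathbb{E}[T_D(k)-T_D(k-1)]$ be the departure rate. For $d\ge0$ put $$g(k)=\min\{(X_{k-1}+I_k+X_k-d)^+,\;X_k+I_k\}.$$ Then for every $d\ge 0$ and $k\ge 1$: $I_k\sim\mathrm{Exp}(\lambda)$, and $X_{k-1},I_k,X_k$ are independent; $\frac1\nu=\frac1\lambda+\frac1\mu$; $g(k)$ is integrable; and the violation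 probability $\mathbb{P}(\Delta>d)=\lim_{t\to\infty}\mathbb{P}(\Delta(t)>d)$, if this limit exists, equals $\nu\,\mathbb{E}[g(k)]$. Moreover, on almost every sample path, the fraction of the time interval $[0,T]$ during which $\Delta>d$ converges to $\nu\,\mathbb{E}[g(k)]$ as $T\to\infty$. -/

import Mathlib

open MeasureTheory ProbabilityTheory Filter Topology

noncomputable section

namespace MGI11

variable {Ω : Type*}

/-- Instant of the `j`-th arrival (`j = 0, 1, 2, …`), discarded or not: `Z 0` is the time of the
first arrival and `Z (j + 1)` the time between the arrivals `j` and `j + 1`. -/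
def arrivalTime (Z : ℕ → Ω → ℝ) (j : ℕ) (ω : Ω) : ℝ :=
  ∑ i ∈ Finset.range (j + 1), Z i ω

/-- The number, among all arrivals, of the `k`-th packet that is served, in a system with one server
and no waiting room that is empty at time `0`; the service of the `k`-th served packet takes
time `X k`. The first arrival finds the server idle; after packet `k` has been taken into service,
the next packet served is the first later arrival that does not find the server busy. -/
def servedIndex (Z X : ℕ → Ω → ℝ) : ℕ → Ω → ℕ
  | 0, _ => 0
  | k + 1, ω => sInf {j : ℕ | servedIndex Z X k ω < j ∧
      arrivalTime Z (servedIndex Z X k ω) ω + X k ω ≤ arrivalTime Z j ω}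

/-- Arrival instant of (served) packet `k`. -/
def TA (Z X : ℕ → Ω → ℝ) (k : ℕ) (ω : Ω) : ℝ :=
  arrivalTime Z (servedIndex Z X k ω) ω

/-- Departure instant of packet `k`, which is served upon its arrival. -/
def TD (Z X : ℕ → Ω → ℝ) (k : ℕ) (ω : Ω) : ℝ :=
  TA Z X k ω + X k ω

/-- Age of information at time `t`: `t - max {TA n : TD n ≤ t}`. Before the first departure
the set is empty, its supremum is `0`, and the age is `t`. -/
def age (Z X : ℕ → Ω → ℝ) (t : ℝ) (ω : Ω) : ℝ :=
  t - sSup {s : ℝ | ∃ n : ℕ, TD Z X n ω ≤ t ∧ s = TA Z X n ω}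

/-- Idle time of the server just before the service of packet `k`, for `k ≥ 1`. -/
def idleTime (Z X : ℕ → Ω → ℝ) (k : ℕ) (ω : Ω) : ℝ :=
  TA Z X k ω - TD Z X (k - 1) ω

/-- `g(k) = min {(X_{k-1} + I_k + X_k - d)⁺, X_k + I_k}`, for `k ≥ 1`. -/
def g (Z X : ℕ → Ω → ℝ) (d : ℝ) (k : ℕ) (ω : Ω) : ℝ :=
  min (max (X (k - 1) ω + idleTime Z X k ω + X k ω - d) 0) (X k ω + idleTime Z X k ω)

variable [MeasurableSpace Ω]

/-- Departure rate `ν = 1 / E[TD k - TD (k - 1)]`, for `k ≥ 1`. -/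
def departureRate (P : Measure Ω) (Z X : ℕ → Ω → ℝ) (k : ℕ) : ℝ :=
  1 / ∫ ω, (TD Z X k ω - TD Z X (k - 1) ω) ∂P

/-- The data of an M/GI/1/1 system with arrival rate `lam`: inter-arrival times `Z` with law
`Exp(lam)`, identically distributed nonnegative service times `X`, and all of
`Z 0, Z 1, …, X 0, X 1, …` mutually independent. -/
structure IsSystem (P : Measure Ω) (lam : ℝ) (Z X : ℕ → Ω → ℝ) : Prop where
  measurable_Z : ∀ n, Measurable (Z n)
  measurable_X : ∀ n, Measurable (X n)
  map_Z : ∀ n, P.map (Z n) = expMeasure lam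
  identDistrib_X : ∀ n, IdentDistrib (X n) (X 0) P P
  nonneg_X : ∀ n, ∀ᵐ ω ∂P, 0 ≤ X n ω
  indep : iIndepFun (Sum.elim Z X) P

end MGI11

end

/-! Fix a path with nonnegative service times and arrivals tending to infinity. Between two
successive departures the age is `t - TA n`, growing with slope one, so it exceeds `d` there for a
time of exactly `g (n + 1)` (`IsRegularPath.violationTime_TD_succ`). The violation time up to
departure `n` is thus an initial term plus a sum of `g`'s, and the departure instant is an initial
term plus a sum of idle and service times.

The probabilistic core is that the idle times are i.i.d. exponential and jointly independent of the
service times. By memorylessness, for a deterministic level `x ≥ 0`, the overshoot of the arrival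
process over `x` is exponential and independent of the gaps that follow, which form a fresh
exponential sequence (`expSeq_overshoot_afterCrossing`). Iterating, for any fixed service times the
idle times have the law `expSeq`; as this law does not depend on the service times, independence
follows (`IsSystem.measurePreserving_idleSeq`).

The `g`'s are then identically distributed, and independent when their indices differ by at least
two. Strong laws along even and odd indices give the long-run ratio at departures, and a monotone
sandwich extends it to all `T`. If the violation probability has a limit, Fubini makes it the limit
of the expected violation fraction, while bounded convergence makes that limit the pathwise one
(`IsSystem.violationProbability_eq`). -/

namespace MGI11

/-! ### Memorylessness and mean of the exponential law -/

section Exponential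

lemma expMeasure_eq_withDensity (r : ℝ) :
    expMeasure r = volume.withDensity (exponentialPDF r) := rfl

lemma measurable_exponentialPDF (r : ℝ) : Measurable (exponentialPDF r) :=
  (measurable_exponentialPDFReal r).ennreal_ofReal

/-- Memorylessness: shifting by `u` multiplies the density on the half-line by `exp (-(r * u))`, and
Lebesgue measure is translation invariant. -/
lemma expMeasure_setOf_le_sub_mem {r : ℝ} {u : ℝ} (hu : 0 ≤ u) {A : Set ℝ}
    (hA : MeasurableSet A) :
    expMeasure r {z | u ≤ z ∧ z - u ∈ A} =
      ENNReal.ofReal (Real.exp (-(r * u))) * expMeasure r A := by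
  have hm : MeasurableSet {z : ℝ | u ≤ z ∧ z - u ∈ A} :=
    (measurableSet_le measurable_const measurable_id).inter
      ((measurable_id.sub_const u) hA)
  rw [expMeasure_eq_withDensity, withDensity_apply _ hm, withDensity_apply _ hA,
    ← lintegral_indicator hm, ← lintegral_indicator hA,
    ← lintegral_const_mul _ ((measurable_exponentialPDF r).indicator hA),
    ← lintegral_sub_right_eq_self (fun w => ENNReal.ofReal (Real.exp (-(r * u))) *
      A.indicator (exponentialPDF r) w) u]
  refine lintegral_congr fun z => ?_
  by_cases hzA : z - u ∈ A
  · by_cases hz : u ≤ z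
    · rw [Set.indicator_of_mem (show z ∈ {z : ℝ | u ≤ z ∧ z - u ∈ A} from ⟨hz, hzA⟩),
        Set.indicator_of_mem hzA, exponentialPDF_of_nonneg (hu.trans hz),
        exponentialPDF_of_nonneg (sub_nonneg.2 hz), ← ENNReal.ofReal_mul (Real.exp_pos _).le]
      congr 1
      rw [mul_left_comm, ← Real.exp_add]
      ring_nf
    · rw [Set.indicator_of_notMem (fun h => hz h.1), Set.indicator_of_mem hzA,
        exponentialPDF_of_neg (by linarith), mul_zero]
  · rw [Set.indicator_of_notMem (fun h => hzA h.2), Set.indicator_of_notMem hzA, mul_zero]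

lemma expMeasure_Ici {r : ℝ} (hr : 0 < r) {u : ℝ} (hu : 0 ≤ u) :
    expMeasure r (Set.Ici u) = ENNReal.ofReal (Real.exp (-(r * u))) := by
  have := isProbabilityMeasure_expMeasure hr
  have := expMeasure_setOf_le_sub_mem (r := r) hu MeasurableSet.univ
  simpa [Set.Ici] using this

lemma ae_expMeasure_nonneg {r : ℝ} (hr : 0 < r) : ∀ᵐ z ∂(expMeasure r), 0 ≤ z := by
  have := isProbabilityMeasure_expMeasure hr
  have h := expMeasure_Ici hr le_rfl
  simp only [mul_zero, neg_zero, Real.exp_zero, ENNReal.ofReal_one] at h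
  exact (prob_compl_eq_zero_iff measurableSet_Ici).2 h

lemma expMeasure_real_Ico {r : ℝ} (hr : 0 < r) {u : ℝ} (hu : 0 ≤ u) :
    (expMeasure r).real (Set.Ico 0 u) = 1 - Real.exp (-(r * u)) := by
  have := isProbabilityMeasure_expMeasure hr
  have h : Set.Ici (0 : ℝ) \ Set.Ici u = Set.Ico 0 u := by
    ext z; simp
  rw [← h, measureReal_sdiff (Set.Ici_subset_Ici.2 hu) measurableSet_Ici, measureReal_def,
    measureReal_def, expMeasure_Ici hr hu, expMeasure_Ici hr le_rfl]
  simp [Real.exp_nonneg]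

/-- Multiplying the exponential density by `z` gives `1 / r` times the Gamma density of shape 2,
whose mass is one. -/
lemma lintegral_ofReal_expMeasure {r : ℝ} (hr : 0 < r) :
    ∫⁻ z, ENNReal.ofReal z ∂(expMeasure r) = ENNReal.ofReal (1 / r) := by
  have h2 : ∀ z : ℝ, exponentialPDF r z * ENNReal.ofReal z =
      ENNReal.ofReal (1 / r) * gammaPDF 2 r z := by
    intro z
    by_cases hz : 0 ≤ z
    · rw [exponentialPDF_of_nonneg hz, gammaPDF_of_nonneg hz, ← ENNReal.ofReal_mul (by positivity),
        ← ENNReal.ofReal_mul (by positivity)]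
      congr 1
      have : (2 : ℝ) - 1 = 1 := by norm_num
      rw [this, Real.Gamma_two, Real.rpow_one, Real.rpow_two]
      field_simp
    · rw [exponentialPDF_of_neg (not_le.1 hz), gammaPDF_of_neg (not_le.1 hz)]
      simp
  rw [expMeasure_eq_withDensity, lintegral_withDensity_eq_lintegral_mul _
    (measurable_exponentialPDF r) ENNReal.measurable_ofReal]
  simp only [Pi.mul_apply, h2]
  rw [lintegral_const_mul (f := gammaPDF 2 r) _ (measurable_gammaPDFReal 2 r).ennreal_ofReal,
    lintegral_gammaPDF_eq_one two_pos hr, mul_one]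

lemma integrable_id_expMeasure {r : ℝ} (hr : 0 < r) :
    Integrable (fun z : ℝ => z) (expMeasure r) := by
  refine ⟨measurable_id.aestronglyMeasurable, ?_⟩
  rw [hasFiniteIntegral_iff_ofReal (ae_expMeasure_nonneg hr), lintegral_ofReal_expMeasure hr]
  exact ENNReal.ofReal_lt_top

lemma integral_id_expMeasure {r : ℝ} (hr : 0 < r) : ∫ z, z ∂(expMeasure r) = 1 / r := by
  rw [integral_eq_lintegral_of_nonneg_ae (ae_expMeasure_nonneg hr)
    measurable_id.aestronglyMeasurable, lintegral_ofReal_expMeasure hr,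
    ENNReal.toReal_ofReal (by positivity)]

end Exponential

/-! ### Product measures on sequences and first passage of partial sums -/

section Sequences

/-- The sequence `a, z 0, z 1, …`. -/
def consSeq (a : ℝ) (z : ℕ → ℝ) : ℕ → ℝ
  | 0 => a
  | n + 1 => z n

lemma measurable_consSeq : Measurable fun p : ℝ × (ℕ → ℝ) => consSeq p.1 p.2 := by
  refine measurable_pi_lambda _ fun n => ?_
  cases n with
  | zero => exact measurable_fst
  | succ n => exact (measurable_pi_apply n).comp measurable_snd

lemma sum_range_consSeq (a : ℝ) (z : ℕ → ℝ) (m : ℕ) :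
    ∑ i ∈ Finset.range (m + 1), consSeq a z i = a + ∑ i ∈ Finset.range m, z i := by
  rw [Finset.sum_range_succ', add_comm]; rfl

/-- Any finite index set lies in some `range n`, and the missing coordinates can be filled with
`univ`, of mass one. Product laws can thus be proved by induction on the number of coordinates. -/
lemma eq_infinitePi_of_initial {μ : Measure ℝ} [IsProbabilityMeasure μ] {ν : Measure (ℕ → ℝ)}
    (h : ∀ (n : ℕ) (t : ℕ → Set ℝ), (∀ i, MeasurableSet (t i)) →
      ν {z | ∀ i < n, z i ∈ t i} = ∏ i ∈ Finset.range n, μ (t i)) :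
    ν = Measure.infinitePi fun _ => μ := by
  classical
  refine Measure.eq_infinitePi _ fun s t ht => ?_
  obtain ⟨n, hn⟩ := s.exists_nat_subset_range
  have := h n (fun i => if i ∈ s then t i else Set.univ) (fun i => by split_ifs <;> simp [ht])
  rw [← Finset.prod_subset hn (f := fun i => μ (if i ∈ s then t i else Set.univ))
    (fun i _ hi => by simp [hi])] at this
  rw [Finset.prod_congr rfl (fun i hi => by rw [if_pos hi])] at this
  rw [← this]
  congr 1
  ext z
  simp only [Set.mem_pi, Finset.mem_coe, Set.mem_ofPred_eq]
  constructor
  · intro hz i _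
    split_ifs with hi
    · exact hz i hi
    · trivial
  · intro hz i hi
    simpa [hi] using hz i (Finset.mem_range.1 (hn hi))

lemma infinitePi_initial {μ : Measure ℝ} [IsProbabilityMeasure μ] (n : ℕ) (t : ℕ → Set ℝ)
    (ht : ∀ i, MeasurableSet (t i)) :
    (Measure.infinitePi fun _ : ℕ => μ) {z | ∀ i < n, z i ∈ t i} =
      ∏ i ∈ Finset.range n, μ (t i) := by
  rw [← Measure.infinitePi_pi (fun _ : ℕ => μ) (fun i _ => ht i)]
  congr 1
  ext z
  simp [Set.mem_pi]

lemma measurableSet_initial {n : ℕ} {t : ℕ → Set ℝ} (ht : ∀ i, MeasurableSet (t i)) :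
    MeasurableSet {z : ℕ → ℝ | ∀ i < n, z i ∈ t i} := by
  simp only [Set.ofPred_forall]
  exact MeasurableSet.iInter fun i => MeasurableSet.iInter fun _ => measurable_pi_apply i (ht i)

/-- This is what permits conditioning on the first gap of an i.i.d. sequence. -/
lemma measurePreserving_consSeq (μ : Measure ℝ) [IsProbabilityMeasure μ] :
    MeasurePreserving (fun p : ℝ × (ℕ → ℝ) => consSeq p.1 p.2)
      (μ.prod (Measure.infinitePi fun _ => μ)) (Measure.infinitePi fun _ => μ) := by
  refine ⟨measurable_consSeq, eq_infinitePi_of_initial fun n t ht => ?_⟩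
  rw [Measure.map_apply measurable_consSeq (measurableSet_initial ht)]
  cases n with
  | zero => simp
  | succ n =>
    have : (fun p : ℝ × (ℕ → ℝ) => consSeq p.1 p.2) ⁻¹' {z | ∀ i < n + 1, z i ∈ t i} =
        t 0 ×ˢ {z | ∀ i < n, z i ∈ t (i + 1)} := by
      ext ⟨a, z⟩
      simp only [Set.mem_preimage, Set.mem_ofPred_eq, Set.mem_prod]
      constructor
      · exact fun h => ⟨h 0 (Nat.succ_pos n), fun i hi => h (i + 1) (Nat.succ_lt_succ hi)⟩
      · rintro ⟨h0, h⟩ (_ | i) hi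
        · exact h0
        · exact h i (Nat.lt_of_succ_lt_succ hi)
    rw [this, Measure.prod_prod, infinitePi_initial n _ (fun i => ht _), Finset.prod_range_succ',
      mul_comm]

lemma measurable_sInf_setOf {α : Type*} [MeasurableSpace α] {p : ℕ → α → Prop}
    (hp : ∀ n, MeasurableSet {a | p n a}) : Measurable fun a => sInf {n | p n a} := by
  classical
  refine measurable_to_countable' fun n => ?_
  -- The second piece accounts for the default value `sInf ∅ = 0`.
  have : (fun a => sInf {n | p n a}) ⁻¹' {n} =
      ({a | p n a} ∩ ⋂ m < n, {a | p m a}ᶜ) ∪ ({_a | n = 0} ∩ ⋂ m, {a | p m a}ᶜ) := by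
    ext a
    simp only [Set.mem_preimage, Set.mem_singleton_iff, Set.mem_union, Set.mem_inter_iff,
      Set.mem_ofPred_eq, Set.mem_iInter, Set.mem_compl_iff]
    constructor
    · intro h
      rcases Set.eq_empty_or_nonempty {n | p n a} with he | hne
      · right
        refine ⟨by rw [← h, he, Nat.sInf_empty], fun m hm => ?_⟩
        have : m ∈ {n | p n a} := hm
        simp [he] at this
      · left
        refine ⟨h ▸ Nat.sInf_mem hne, fun m hm hpm => ?_⟩
        exact Nat.notMem_of_lt_sInf (h ▸ hm) hpm
    · rintro (⟨h1, h2⟩ | ⟨rfl, h2⟩)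
      · refine le_antisymm (Nat.sInf_le h1) ?_
        by_contra! hlt
        exact h2 _ hlt (Nat.sInf_mem (s := {n | p n a}) ⟨n, h1⟩)
      · rw [Set.eq_empty_of_forall_notMem (s := {n | p n a}) h2, Nat.sInf_empty]
  rw [this]
  exact ((hp n).inter (MeasurableSet.iInter fun m => MeasurableSet.iInter fun _ => (hp m).compl)).union
    ((MeasurableSet.const _).inter (MeasurableSet.iInter fun m => (hp m).compl))

lemma _root_.Measurable.apply_nat {α β : Type*} [MeasurableSpace α] [MeasurableSpace β]
    {f : ℕ → α → β} {N : α → ℕ} (hf : ∀ n, Measurable (f n)) (hN : Measurable N) :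
    Measurable fun a => f (N a) a :=
  (measurable_from_prod_countable_right (f := fun p : ℕ × α => f p.1 p.2) hf).comp
    (hN.prodMk measurable_id)

/-- The first index at which the partial sums of `z` reach the level `x`. -/
noncomputable def crossing (x : ℝ) (z : ℕ → ℝ) : ℕ :=
  sInf {m : ℕ | x ≤ ∑ i ∈ Finset.range (m + 1), z i}

/-- The excess of the partial sums of `z` over the level `x` when they first reach it. -/
noncomputable def overshoot (x : ℝ) (z : ℕ → ℝ) : ℝ :=
  ∑ i ∈ Finset.range (crossing x z + 1), z i - x

/-- The terms of `z` after its partial sums have first reached the level `x`. -/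
noncomputable def afterCrossing (x : ℝ) (z : ℕ → ℝ) : ℕ → ℝ :=
  fun i => z (crossing x z + 1 + i)

lemma measurable_partialSum (m : ℕ) :
    Measurable fun z : ℕ → ℝ => ∑ i ∈ Finset.range m, z i :=
  Finset.measurable_fun_sum _ fun i _ => measurable_pi_apply i

lemma measurable_crossing : Measurable fun p : ℝ × (ℕ → ℝ) => crossing p.1 p.2 :=
  measurable_sInf_setOf fun m =>
    measurableSet_le measurable_fst ((measurable_partialSum (m + 1)).comp measurable_snd)

lemma measurable_overshoot : Measurable fun p : ℝ × (ℕ → ℝ) => overshoot p.1 p.2 :=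
  (Measurable.apply_nat (f := fun m (p : ℝ × (ℕ → ℝ)) => ∑ i ∈ Finset.range (m + 1), p.2 i)
    (fun m => (measurable_partialSum (m + 1)).comp measurable_snd) measurable_crossing).sub
    measurable_fst

lemma measurable_afterCrossing : Measurable fun p : ℝ × (ℕ → ℝ) => afterCrossing p.1 p.2 :=
  measurable_pi_lambda _ fun i =>
    Measurable.apply_nat (f := fun m (p : ℝ × (ℕ → ℝ)) => p.2 (m + 1 + i))
      (fun m => (measurable_pi_apply (m + 1 + i)).comp measurable_snd) measurable_crossing

lemma crossing_consSeq_of_le {x a : ℝ} (h : x ≤ a) (z : ℕ → ℝ) : crossing x (consSeq a z) = 0 :=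
  Nat.sInf_eq_zero.2 (Or.inl (by simpa [consSeq] using h))

lemma overshoot_consSeq_of_le {x a : ℝ} (h : x ≤ a) (z : ℕ → ℝ) :
    overshoot x (consSeq a z) = a - x := by
  simp [overshoot, crossing_consSeq_of_le h, consSeq]

lemma afterCrossing_consSeq_of_le {x a : ℝ} (h : x ≤ a) (z : ℕ → ℝ) :
    afterCrossing x (consSeq a z) = z := by
  funext i
  simp only [afterCrossing, crossing_consSeq_of_le h]
  rw [zero_add, add_comm]; rfl

lemma exists_le_partialSum {z : ℕ → ℝ}
    (hz : Tendsto (fun n => ∑ i ∈ Finset.range n, z i) atTop atTop) (x : ℝ) :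
    {m : ℕ | x ≤ ∑ i ∈ Finset.range (m + 1), z i}.Nonempty :=
  (((tendsto_add_atTop_iff_nat 1).2 hz).eventually_ge_atTop x).exists

/-- Divergence guarantees that the level is reached; otherwise both infima default to `0` and the
shift by one fails. -/
lemma crossing_consSeq_of_lt {x a : ℝ} (h : a < x) {z : ℕ → ℝ}
    (hz : Tendsto (fun n => ∑ i ∈ Finset.range n, z i) atTop atTop) :
    crossing x (consSeq a z) = crossing (x - a) z + 1 := by
  have hmem : ∀ m, x ≤ ∑ i ∈ Finset.range (m + 1 + 1), consSeq a z i ↔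
      x - a ≤ ∑ i ∈ Finset.range (m + 1), z i := fun m => by
    rw [sum_range_consSeq, sub_le_iff_le_add']
  have hne := exists_le_partialSum hz (x - a)
  refine le_antisymm (Nat.sInf_le ((hmem _).2 (Nat.sInf_mem hne))) ?_
  have h' : x ≤ ∑ i ∈ Finset.range (crossing x (consSeq a z) + 1), consSeq a z i :=
    Nat.sInf_mem (s := {m | x ≤ ∑ i ∈ Finset.range (m + 1), consSeq a z i})
      ⟨_, (hmem _).2 (Nat.sInf_mem hne)⟩
  rcases hc : crossing x (consSeq a z) with _ | m
  · rw [hc] at h'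
    simp [consSeq] at h'
    exact absurd h (not_lt.2 h')
  · rw [hc] at h'
    exact Nat.succ_le_succ (Nat.sInf_le ((hmem m).1 h'))

lemma overshoot_consSeq_of_lt {x a : ℝ} (h : a < x) {z : ℕ → ℝ}
    (hz : Tendsto (fun n => ∑ i ∈ Finset.range n, z i) atTop atTop) :
    overshoot x (consSeq a z) = overshoot (x - a) z := by
  rw [overshoot, overshoot, crossing_consSeq_of_lt h hz, sum_range_consSeq]
  ring

lemma afterCrossing_consSeq_of_lt {x a : ℝ} (h : a < x) {z : ℕ → ℝ}
    (hz : Tendsto (fun n => ∑ i ∈ Finset.range n, z i) atTop atTop) :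
    afterCrossing x (consSeq a z) = afterCrossing (x - a) z := by
  funext i
  rw [afterCrossing, afterCrossing, crossing_consSeq_of_lt h hz]
  rw [show crossing (x - a) z + 1 + 1 + i = (crossing (x - a) z + 1 + i) + 1 by ring]
  rfl

end Sequences

/-! ### Renewal equation for the overshoot; law of the idle times for fixed service times -/

section Renewal

/-- The law of a sequence of independent `Exp(r)` random variables. -/
noncomputable def expSeq (r : ℝ) : Measure (ℕ → ℝ) :=
  Measure.infinitePi fun _ => expMeasure r

lemma isProbabilityMeasure_expSeq {r : ℝ} (hr : 0 < r) : IsProbabilityMeasure (expSeq r) := by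
  have := isProbabilityMeasure_expMeasure hr
  unfold expSeq
  infer_instance

lemma ae_expSeq_tendsto {r : ℝ} (hr : 0 < r) :
    ∀ᵐ z ∂(expSeq r), Tendsto (fun n => ∑ i ∈ Finset.range n, z i) atTop atTop := by
  have := isProbabilityMeasure_expMeasure hr
  have hmap : ∀ i, (expSeq r).map (fun z : ℕ → ℝ => z i) = expMeasure r := fun i =>
    (measurePreserving_eval_infinitePi (fun _ => expMeasure r) i).map_eq
  have hident : ∀ i, IdentDistrib (fun z : ℕ → ℝ => z i) (fun z : ℕ → ℝ => z 0)
      (expSeq r) (expSeq r) := fun i =>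
    ⟨(measurable_pi_apply i).aemeasurable, (measurable_pi_apply 0).aemeasurable,
      (hmap i).trans (hmap 0).symm⟩
  have hind : iIndepFun (fun (i : ℕ) (z : ℕ → ℝ) => z i) (expSeq r) :=
    iIndepFun_infinitePi (P := fun _ : ℕ => expMeasure r) (X := fun _ x => x)
      (fun _ => measurable_id)
  have hint : Integrable (fun z : ℕ → ℝ => z 0) (expSeq r) := by
    have := integrable_id_expMeasure hr
    rw [← hmap 0] at this
    exact this.comp_measurable (measurable_pi_apply 0)
  have hmean : ∫ z, z 0 ∂(expSeq r) = 1 / r := by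
    have h0 : ∫ y, y ∂(expSeq r).map (fun z : ℕ → ℝ => z 0) = ∫ z, z 0 ∂(expSeq r) :=
      integral_map (φ := fun z : ℕ → ℝ => z 0) (f := fun y : ℝ => y)
        (measurable_pi_apply 0).aemeasurable measurable_id.aestronglyMeasurable
    rw [← h0, hmap 0, integral_id_expMeasure hr]
  filter_upwards [strong_law_ae_real (fun (i : ℕ) (z : ℕ → ℝ) => z i) hint
    (fun i j hij => hind.indepFun hij) hident] with z hz
  rw [hmean] at hz
  have h := hz.pos_mul_atTop (by positivity) (tendsto_natCast_atTop_atTop (R := ℝ))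
  refine h.congr' ?_
  filter_upwards [eventually_ge_atTop 1] with n hn
  have : (n : ℝ) ≠ 0 := by positivity
  field_simp

lemma measurableSet_overshoot_afterCrossing {A : Set ℝ} {B : Set (ℕ → ℝ)} (hA : MeasurableSet A)
    (hB : MeasurableSet B) :
    MeasurableSet {p : ℝ × (ℕ → ℝ) | overshoot p.1 p.2 ∈ A ∧ afterCrossing p.1 p.2 ∈ B} :=
  (measurable_overshoot hA).inter (measurable_afterCrossing hB)

/-- Condition on the first gap `a`. If `a ≥ x`, the level is crossed at once and memorylessness
gives the product term; if `a < x`, the process starts afresh with level `x - a`. -/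
lemma expSeq_overshoot_afterCrossing_recursion {r : ℝ} (hr : 0 < r) {x : ℝ} (hx : 0 ≤ x)
    {A : Set ℝ} {B : Set (ℕ → ℝ)} (hA : MeasurableSet A) (hB : MeasurableSet B) :
    expSeq r {z | overshoot x z ∈ A ∧ afterCrossing x z ∈ B} =
      ENNReal.ofReal (Real.exp (-(r * x))) * (expMeasure r A * expSeq r B) +
        ∫⁻ a in Set.Ico 0 x,
          expSeq r {z | overshoot (x - a) z ∈ A ∧ afterCrossing (x - a) z ∈ B} ∂(expMeasure r) := by
  have := isProbabilityMeasure_expMeasure hr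
  have := isProbabilityMeasure_expSeq hr
  have hm := (measurableSet_overshoot_afterCrossing hA hB).preimage
    (measurable_const.prodMk measurable_id : Measurable fun z : ℕ → ℝ => (x, z))
  have hmp : MeasurePreserving (fun p : ℝ × (ℕ → ℝ) => consSeq p.1 p.2)
      ((expMeasure r).prod (expSeq r)) (expSeq r) := measurePreserving_consSeq (expMeasure r)
  have h1 := hmp.measure_preimage hm.nullMeasurableSet
  rw [Measure.prod_apply (hmp.measurable hm)] at h1
  change _ = expSeq r {z | overshoot x z ∈ A ∧ afterCrossing x z ∈ B} at h1
  rw [← h1, ← lintegral_add_compl _ (measurableSet_Ici (a := x))]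
  congr 1
  · have : ∀ a ∈ Set.Ici x, expSeq r (Prod.mk a ⁻¹' ((fun p : ℝ × (ℕ → ℝ) => consSeq p.1 p.2) ⁻¹'
        ((fun z => (x, z)) ⁻¹' {p : ℝ × (ℕ → ℝ) | overshoot p.1 p.2 ∈ A ∧
          afterCrossing p.1 p.2 ∈ B}))) =
        {a | x ≤ a ∧ a - x ∈ A}.indicator (fun _ => expSeq r B) a := by
      intro a ha
      by_cases haA : a - x ∈ A
      · rw [Set.indicator_of_mem (show a ∈ {a | x ≤ a ∧ a - x ∈ A} from ⟨ha, haA⟩)]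
        congr 1
        ext z
        simp [overshoot_consSeq_of_le ha, afterCrossing_consSeq_of_le ha, haA]
      · rw [Set.indicator_of_notMem (fun h => haA h.2), ← measure_empty (μ := expSeq r)]
        congr 1
        ext z
        simp [overshoot_consSeq_of_le ha, haA]
    have hm' : MeasurableSet {a : ℝ | x ≤ a ∧ a - x ∈ A} :=
      (measurableSet_le measurable_const measurable_id).inter
        ((measurable_id.sub_const x) hA)
    rw [setLIntegral_congr_fun measurableSet_Ici this, setLIntegral_indicator hm',
      setLIntegral_const, Set.inter_eq_left.2 (fun a ha => ha.1),
      expMeasure_setOf_le_sub_mem hx hA]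
    ring
  · rw [Set.compl_Ici]
    have hae : (Set.Iio x : Set ℝ) =ᵐ[expMeasure r] Set.Ico 0 x := by
      filter_upwards [ae_expMeasure_nonneg hr] with a ha
      exact propext ⟨fun h => ⟨ha, h⟩, fun h => h.2⟩
    rw [setLIntegral_congr hae]
    refine setLIntegral_congr_fun measurableSet_Ico fun a ha => measure_congr ?_
    filter_upwards [ae_expSeq_tendsto hr] with z hz
    refine propext ?_
    change (overshoot x (consSeq a z) ∈ A ∧ afterCrossing x (consSeq a z) ∈ B) ↔
      (overshoot (x - a) z ∈ A ∧ afterCrossing (x - a) z ∈ B)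
    rw [overshoot_consSeq_of_lt ha.2 hz, afterCrossing_consSeq_of_lt ha.2 hz]

/-- The probability, as a function of the level, and the constant `K` solve the same renewal
equation. On `[0, x]` its integral operator is a strict contraction for the sup norm, so the two
bounded solutions agree. -/
lemma expSeq_overshoot_afterCrossing {r : ℝ} (hr : 0 < r) {x : ℝ} (hx : 0 ≤ x)
    {A : Set ℝ} {B : Set (ℕ → ℝ)} (hA : MeasurableSet A) (hB : MeasurableSet B) :
    expSeq r {z | overshoot x z ∈ A ∧ afterCrossing x z ∈ B} = expMeasure r A * expSeq r B := by
  have := isProbabilityMeasure_expMeasure hr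
  have := isProbabilityMeasure_expSeq hr
  set K : ℝ := (expMeasure r A * expSeq r B).toReal with hK
  set h : ℝ → ℝ := fun y =>
    (expSeq r {z | overshoot y z ∈ A ∧ afterCrossing y z ∈ B}).toReal with hh
  have hmeas : Measurable h := (measurable_measure_prodMk_left
    (measurableSet_overshoot_afterCrossing hA hB)).ennreal_toReal
  have hK0 : 0 ≤ K := ENNReal.toReal_nonneg
  have hK1 : K ≤ 1 := by
    refine ENNReal.toReal_le_of_le_ofReal zero_le_one ?_
    rw [ENNReal.ofReal_one]
    exact mul_le_one' prob_le_one prob_le_one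
  have hh0 : ∀ y, 0 ≤ h y := fun y => ENNReal.toReal_nonneg
  have hh1 : ∀ y, h y ≤ 1 := fun y => measureReal_le_one
  have hint : ∀ y, Integrable (fun a => h (y - a)) ((expMeasure r).restrict (Set.Ico 0 y)) :=
    fun y => Integrable.of_bound (hmeas.comp (measurable_const.sub measurable_id)).aestronglyMeasurable
      1 (ae_of_all _ fun a => by rw [Real.norm_of_nonneg (hh0 _)]; exact hh1 _)
  -- Subtract `K = exp (-(r * y)) * K + (1 - exp (-(r * y))) * K` from the recursion for `h`.
  have hrec : ∀ y, 0 ≤ y → h y - K = ∫ a in Set.Ico 0 y, (h (y - a) - K) ∂(expMeasure r) := by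
    intro y hy
    rw [integral_sub (hint y) (integrable_const _), setIntegral_const, expMeasure_real_Ico hr hy,
      smul_eq_mul]
    have hi : ∫ a in Set.Ico 0 y, h (y - a) ∂(expMeasure r) = (∫⁻ a in Set.Ico 0 y,
        expSeq r {z | overshoot (y - a) z ∈ A ∧ afterCrossing (y - a) z ∈ B}
          ∂(expMeasure r)).toReal :=
      integral_toReal ((measurable_measure_prodMk_left
        (measurableSet_overshoot_afterCrossing hA hB)).comp
          (measurable_const.sub measurable_id)).aemeasurable (ae_of_all _ fun a => measure_lt_top _ _)
    have hfin : ∫⁻ a in Set.Ico 0 y,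
        expSeq r {z | overshoot (y - a) z ∈ A ∧ afterCrossing (y - a) z ∈ B}
          ∂(expMeasure r) ≠ ⊤ := by
      refine ne_top_of_le_ne_top (b := 1) ENNReal.one_ne_top ?_
      calc _ ≤ ∫⁻ a in Set.Ico 0 y, 1 ∂(expMeasure r) := lintegral_mono fun a => prob_le_one
        _ ≤ 1 := by rw [setLIntegral_const, one_mul]; exact prob_le_one
    have h2 : h y = Real.exp (-(r * y)) * K + ∫ a in Set.Ico 0 y, h (y - a) ∂(expMeasure r) := by
      rw [hi]
      simp only [hh]
      rw [expSeq_overshoot_afterCrossing_recursion hr hy hA hB, ENNReal.toReal_add _ hfin,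
        ENNReal.toReal_mul, ENNReal.toReal_ofReal (Real.exp_pos _).le]
      exact ENNReal.mul_ne_top ENNReal.ofReal_ne_top
        (ENNReal.mul_ne_top (measure_ne_top _ _) (measure_ne_top _ _))
    rw [h2]; ring
  -- The contraction factor: the exponential mass of `[0, x)`, which dominates that of `[0, y)` for
  -- `y ≤ x`.
  set c : ℝ := 1 - Real.exp (-(r * x)) with hc
  have hc0 : 0 ≤ c := sub_nonneg.2 (Real.exp_le_one_iff.2 (by nlinarith))
  have hc1 : c < 1 := sub_lt_self _ (Real.exp_pos _)
  have hbound : ∀ n : ℕ, ∀ y, 0 ≤ y → y ≤ x → |h y - K| ≤ c ^ n := by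
    intro n
    induction n with
    | zero =>
      intro y _ _
      rw [pow_zero, abs_le]
      constructor <;> linarith [hh0 y, hh1 y]
    | succ n ih =>
      intro y hy hyx
      rw [hrec y hy, ← Real.norm_eq_abs]
      refine (norm_setIntegral_le_of_norm_le_const (C := c ^ n) (measure_lt_top _ _)
        fun a ha => ?_).trans ?_
      · exact ih (y - a) (sub_nonneg.2 ha.2.le) (by linarith [ha.1])
      · rw [expMeasure_real_Ico hr hy, pow_succ]
        refine mul_le_mul_of_nonneg_left ?_ (pow_nonneg hc0 n)
        refine sub_le_sub_left (Real.exp_le_exp.2 ?_) _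
        nlinarith
  have hzero : |h x - K| ≤ 0 :=
    ge_of_tendsto' (tendsto_pow_atTop_nhds_zero_of_lt_one hc0 hc1) fun n => hbound n x hx le_rfl
  have : h x = K := sub_eq_zero.1 (abs_nonpos_iff.1 hzero)
  exact (ENNReal.toReal_eq_toReal_iff' (measure_ne_top _ _)
    (ENNReal.mul_ne_top (measure_ne_top _ _) (measure_ne_top _ _))).1 this

/-- Sequence of arrivals left after the first `k` service periods. -/
noncomputable def residual (x z : ℕ → ℝ) : ℕ → (ℕ → ℝ)
  | 0 => z
  | k + 1 => afterCrossing (x k) (residual x z k)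

/-- The successive idle times of a server with service times `x`, the gaps between the arrivals
after the first served one being `z`. -/
noncomputable def idleSeq (x z : ℕ → ℝ) (k : ℕ) : ℝ :=
  overshoot (x k) (residual x z k)

lemma measurable_residual (k : ℕ) :
    Measurable fun p : (ℕ → ℝ) × (ℕ → ℝ) => residual p.1 p.2 k := by
  induction k with
  | zero => exact measurable_snd
  | succ k ih =>
    have h := measurable_afterCrossing.comp
      (((measurable_pi_apply k).comp (measurable_fst (β := ℕ → ℝ))).prodMk ih)
    exact h

lemma measurable_idleSeq : Measurable fun p : (ℕ → ℝ) × (ℕ → ℝ) => idleSeq p.1 p.2 :=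
  measurable_pi_lambda _ fun k => by
    have h := measurable_overshoot.comp
      (((measurable_pi_apply k).comp (measurable_fst (β := ℕ → ℝ))).prodMk (measurable_residual k))
    exact h

lemma measurable_idleSeq_right (x : ℕ → ℝ) : Measurable (idleSeq x) := by
  have h := measurable_idleSeq.comp
    (measurable_prodMk_left (x := x) : Measurable (Prod.mk x : (ℕ → ℝ) → (ℕ → ℝ) × (ℕ → ℝ)))
  exact h

/-- The definition peels off the last service period; this form peels off the first, as the
induction on idle times requires. -/
lemma residual_succ_eq (x z : ℕ → ℝ) (k : ℕ) :
    residual x z (k + 1) = residual (fun i => x (i + 1)) (afterCrossing (x 0) z) k := by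
  induction k with
  | zero => rfl
  | succ k ih => rw [residual, ih]; rfl

lemma idleSeq_succ_eq (x z : ℕ → ℝ) (k : ℕ) :
    idleSeq x z (k + 1) = idleSeq (fun i => x (i + 1)) (afterCrossing (x 0) z) k := by
  rw [idleSeq, residual_succ_eq]; rfl

lemma expSeq_idleSeq_initial {r : ℝ} (hr : 0 < r) (t : ℕ → Set ℝ)
    (ht : ∀ i, MeasurableSet (t i)) (x : ℕ → ℝ) (hx : ∀ i, 0 ≤ x i) (n : ℕ) :
    expSeq r {z | ∀ i < n, idleSeq x z i ∈ t i} = ∏ i ∈ Finset.range n, expMeasure r (t i) := by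
  have := isProbabilityMeasure_expSeq hr
  induction n generalizing x t with
  | zero => simp
  | succ n ih =>
    have h : {z | ∀ i < n + 1, idleSeq x z i ∈ t i} =
        {z | overshoot (x 0) z ∈ t 0 ∧ afterCrossing (x 0) z ∈
          {y | ∀ i < n, idleSeq (fun i => x (i + 1)) y i ∈ t (i + 1)}} := by
      ext z
      simp only [Set.mem_ofPred_eq]
      constructor
      · exact fun h => ⟨h 0 (Nat.succ_pos n),
          fun i hi => idleSeq_succ_eq x z i ▸ h (i + 1) (Nat.succ_lt_succ hi)⟩
      · rintro ⟨h0, h⟩ (_ | i) hi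
        · exact h0
        · exact idleSeq_succ_eq x z i ▸ h i (Nat.lt_of_succ_lt_succ hi)
    have hm : MeasurableSet
        {y | ∀ i < n, idleSeq (fun i => x (i + 1)) y i ∈ t (i + 1)} :=
      measurable_idleSeq_right (fun i => x (i + 1))
        (measurableSet_initial (n := n) (fun i => ht (i + 1)))
    rw [h, expSeq_overshoot_afterCrossing hr (hx 0) (ht 0) hm,
      ih _ (fun i => ht (i + 1)) _ (fun i => hx (i + 1)), Finset.prod_range_succ', mul_comm]

/-- The law on the right does not involve `x`; this is the source of the independence of idle and
service times. -/
lemma map_idleSeq_expSeq {r : ℝ} (hr : 0 < r) {x : ℕ → ℝ} (hx : ∀ i, 0 ≤ x i) :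
    (expSeq r).map (idleSeq x) = expSeq r := by
  have := isProbabilityMeasure_expMeasure hr
  refine eq_infinitePi_of_initial fun n t ht => ?_
  rw [Measure.map_apply (measurable_idleSeq_right x) (measurableSet_initial ht)]
  exact expSeq_idleSeq_initial hr t ht x hx n

end Renewal

/-! ### Identification of the idle times with overshoots along a path -/

section Paths

variable {Ω : Type*} {Z X : ℕ → Ω → ℝ} {ω : Ω}

/-- A sample path with nonnegative data along which the arrivals do not accumulate. -/
structure IsRegularPath (Z X : ℕ → Ω → ℝ) (ω : Ω) : Prop where
  nonneg_Z : 0 ≤ Z 0 ω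
  nonneg_X : ∀ n, 0 ≤ X n ω
  tendsto_arrivalTime : Tendsto (fun j => arrivalTime Z j ω) atTop atTop

lemma arrivalTime_add (Z : ℕ → Ω → ℝ) (j m : ℕ) (ω : Ω) :
    arrivalTime Z (j + 1 + m) ω =
      arrivalTime Z j ω + ∑ i ∈ Finset.range (m + 1), Z (j + 1 + i) ω := by
  rw [arrivalTime, add_assoc, Finset.sum_range_add]; rfl

lemma IsRegularPath.exists_served (h : IsRegularPath Z X ω) (k : ℕ) :
    {j : ℕ | servedIndex Z X k ω < j ∧
      arrivalTime Z (servedIndex Z X k ω) ω + X k ω ≤ arrivalTime Z j ω}.Nonempty :=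
  ((eventually_gt_atTop _).and (h.tendsto_arrivalTime.eventually_ge_atTop _)).exists

lemma IsRegularPath.TD_le_TA (h : IsRegularPath Z X ω) (k : ℕ) :
    TD Z X k ω ≤ TA Z X (k + 1) ω :=
  (Nat.sInf_mem (h.exists_served k)).2

/-- Writing a later arrival as `servedIndex + 1 + m` makes the strict inequality automatic and turns
the idleness condition into a partial sum of gaps reaching `X k`. -/
lemma IsRegularPath.servedIndex_succ (h : IsRegularPath Z X ω) (k : ℕ) :
    servedIndex Z X (k + 1) ω = servedIndex Z X k ω + 1 +
      crossing (X k ω) (fun i => Z (servedIndex Z X k ω + 1 + i) ω) := by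
  have hiff : ∀ m : ℕ, (servedIndex Z X k ω < servedIndex Z X k ω + 1 + m ∧
      arrivalTime Z (servedIndex Z X k ω) ω + X k ω ≤
        arrivalTime Z (servedIndex Z X k ω + 1 + m) ω) ↔
      X k ω ≤ ∑ i ∈ Finset.range (m + 1), Z (servedIndex Z X k ω + 1 + i) ω := by
    intro m
    rw [arrivalTime_add, add_le_add_iff_left]
    exact and_iff_right (by omega)
  have hne : {m : ℕ | X k ω ≤
      ∑ i ∈ Finset.range (m + 1), Z (servedIndex Z X k ω + 1 + i) ω}.Nonempty := by
    obtain ⟨j, hj⟩ := h.exists_served k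
    obtain ⟨m, rfl⟩ := Nat.exists_eq_add_of_le (Nat.succ_le_of_lt hj.1)
    exact ⟨m, (hiff m).1 hj⟩
  have hs : servedIndex Z X k ω < servedIndex Z X (k + 1) ω ∧
      arrivalTime Z (servedIndex Z X k ω) ω + X k ω ≤
        arrivalTime Z (servedIndex Z X (k + 1) ω) ω :=
    Nat.sInf_mem (h.exists_served k)
  apply le_antisymm
  · exact Nat.sInf_le ((hiff _).2 (Nat.sInf_mem hne))
  · obtain ⟨m, hm⟩ := Nat.exists_eq_add_of_le (Nat.succ_le_of_lt hs.1)
    rw [Nat.succ_eq_add_one] at hm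
    rw [hm] at hs ⊢
    exact Nat.add_le_add_left (Nat.sInf_le ((hiff m).1 hs)) _

lemma IsRegularPath.residual_eq (h : IsRegularPath Z X ω) (k : ℕ) :
    residual (fun i => X i ω) (fun i => Z (i + 1) ω) k =
      fun i => Z (servedIndex Z X k ω + 1 + i) ω := by
  induction k with
  | zero => funext i; simp [residual, servedIndex, add_comm]
  | succ k ih =>
    funext i
    rw [residual, ih, afterCrossing, h.servedIndex_succ k]
    simp only [add_assoc]

lemma IsRegularPath.idleTime_succ (h : IsRegularPath Z X ω) (k : ℕ) :
    idleTime Z X (k + 1) ω = idleSeq (fun i => X i ω) (fun i => Z (i + 1) ω) k := by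
  rw [idleSeq, h.residual_eq, overshoot, idleTime, TA, h.servedIndex_succ, arrivalTime_add,
    Nat.add_sub_cancel, TD, TA]
  ring

end Paths

/-! ### Measurability of the queue -/

section Measurability

variable {Ω : Type*} [MeasurableSpace Ω] {Z X : ℕ → Ω → ℝ}

lemma measurable_arrivalTime (hZ : ∀ n, Measurable (Z n)) (j : ℕ) :
    Measurable (arrivalTime Z j) :=
  Finset.measurable_fun_sum _ fun i _ => hZ i

lemma measurable_servedIndex (hZ : ∀ n, Measurable (Z n)) (hX : ∀ n, Measurable (X n)) (k : ℕ) :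
    Measurable (servedIndex Z X k) := by
  induction k with
  | zero => exact measurable_const
  | succ k ih =>
    refine measurable_sInf_setOf (p := fun j ω => servedIndex Z X k ω < j ∧
      arrivalTime Z (servedIndex Z X k ω) ω + X k ω ≤ arrivalTime Z j ω) fun j => ?_
    exact (measurableSet_lt ih measurable_const).inter (measurableSet_le
      ((Measurable.apply_nat (measurable_arrivalTime hZ) ih).add (hX k))
      (measurable_arrivalTime hZ j))

lemma measurable_TA (hZ : ∀ n, Measurable (Z n)) (hX : ∀ n, Measurable (X n)) (k : ℕ) :
    Measurable (TA Z X k) :=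
  Measurable.apply_nat (f := arrivalTime Z) (measurable_arrivalTime hZ) (measurable_servedIndex hZ hX k)

lemma measurable_TD (hZ : ∀ n, Measurable (Z n)) (hX : ∀ n, Measurable (X n)) (k : ℕ) :
    Measurable (TD Z X k) :=
  (measurable_TA hZ hX k).add (hX k)

lemma measurable_idleTime (hZ : ∀ n, Measurable (Z n)) (hX : ∀ n, Measurable (X n)) (k : ℕ) :
    Measurable (idleTime Z X k) :=
  (measurable_TA hZ hX k).sub (measurable_TD hZ hX (k - 1))

end Measurability

/-! ### Joint independence of service and idle times -/

section Independence

lemma iIndepFun_sumElim {Ω ι κ β : Type*} [MeasurableSpace Ω] [MeasurableSpace β] {P : Measure Ω}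
    {X : ι → Ω → β} {Y : κ → Ω → β} (hX : iIndepFun X P) (hY : iIndepFun Y P)
    (hXY : IndepFun (fun ω i => X i ω) (fun ω j => Y j ω) P) :
    iIndepFun (Sum.elim X Y) P := by
  rw [iIndepFun_iff_measure_inter_preimage_eq_mul]
  intro S sets hS
  have hL : ∀ i ∈ S.toLeft, MeasurableSet (sets (Sum.inl i)) :=
    fun i hi => hS _ (Finset.mem_toLeft.1 hi)
  have hR : ∀ j ∈ S.toRight, MeasurableSet (sets (Sum.inr j)) :=
    fun j hj => hS _ (Finset.mem_toRight.1 hj)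
  have hA : MeasurableSet (⋂ i ∈ S.toLeft, (fun x : ι → β => x i) ⁻¹' sets (Sum.inl i)) :=
    Finset.measurableSet_biInter _ fun i hi => measurable_pi_apply i (hL i hi)
  have hB : MeasurableSet (⋂ j ∈ S.toRight, (fun x : κ → β => x j) ⁻¹' sets (Sum.inr j)) :=
    Finset.measurableSet_biInter _ fun j hj => measurable_pi_apply j (hR j hj)
  have h := hXY.measure_inter_preimage_eq_mul _ _ hA hB
  have h1 := hX.measure_inter_preimage_eq_mul S.toLeft hL
  have h2 := hY.measure_inter_preimage_eq_mul S.toRight hR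
  simp only [Set.preimage_iInter₂] at h
  rw [← Finset.toLeft_disjSum_toRight (u := S), Finset.prod_disjSum]
  refine Eq.trans (congrArg P ?_) (h.trans (congrArg₂ _ h1 h2))
  ext ω
  simp [Set.mem_iInter]

variable {Ω : Type*} [MeasurableSpace Ω] {P : Measure Ω} {lam : ℝ}
  {Z X : ℕ → Ω → ℝ}

lemma IsSystem.iIndepFun_X (h : IsSystem P lam Z X) : iIndepFun X P :=
  h.indep.precomp (g := Sum.inr) Sum.inr_injective

lemma IsSystem.map_Z_succ (h : IsSystem P lam Z X) :
    P.map (fun ω i => Z (i + 1) ω) = expSeq lam := by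
  have hind : iIndepFun (fun i => Z (i + 1)) P :=
    h.indep.precomp (g := fun i => Sum.inl (i + 1)) fun i j hij => by simpa using hij
  rw [hind.map_fun_eq_infinitePi_map fun i => h.measurable_Z (i + 1)]
  simp only [h.map_Z]
  rfl

lemma IsSystem.ae_isRegularPath (h : IsSystem P lam Z X) (hlam : 0 < lam) :
    ∀ᵐ ω ∂P, IsRegularPath Z X ω := by
  have hZ : ∀ᵐ ω ∂P, 0 ≤ Z 0 ω := by
    have := ae_expMeasure_nonneg hlam
    rw [← h.map_Z 0] at this
    exact ae_of_ae_map (h.measurable_Z 0).aemeasurable this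
  have hT := ae_expSeq_tendsto hlam
  rw [← h.map_Z_succ] at hT
  have hT' := ae_of_ae_map
    (measurable_pi_lambda _ fun i => h.measurable_Z (i + 1)).aemeasurable hT
  filter_upwards [hZ, hT', ae_all_iff.2 h.nonneg_X] with ω h1 h2 h3
  refine ⟨h1, h3, ?_⟩
  refine (tendsto_atTop_add_const_right _ (Z 0 ω) h2).congr fun n => ?_
  rw [arrivalTime, Finset.sum_range_succ']

variable [IsProbabilityMeasure P]

lemma IsSystem.indepFun_X_Z (h : IsSystem P lam Z X) :
    IndepFun (fun ω i => X i ω) (fun ω i => Z (i + 1) ω) P := by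
  classical
  have hm : ∀ i, Measurable (Sum.elim Z X i) := by
    rintro (i | i)
    exacts [h.measurable_Z i, h.measurable_X i]
  refine IndepFun.process_indepFun_process h.measurable_X (fun i => h.measurable_Z (i + 1))
    fun I J => ?_
  have hd : Disjoint (I.map Function.Embedding.inr : Finset (ℕ ⊕ ℕ))
      (J.map ((addRightEmbedding 1).trans Function.Embedding.inl)) := by
    rw [Finset.disjoint_left]
    intro a ha hb
    simp only [Finset.mem_map] at ha hb
    obtain ⟨i, _, rfl⟩ := ha
    obtain ⟨j, _, hj⟩ := hb
    simp at hj
  have hind := h.indep.indepFun_finset _ _ hd hm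
  exact hind.comp
    (φ := fun x (i : I) => x ⟨Sum.inr i, Finset.mem_map_of_mem Function.Embedding.inr i.2⟩)
    (ψ := fun x (j : J) => x ⟨Sum.inl (j + 1), Finset.mem_map_of_mem
      ((addRightEmbedding 1).trans Function.Embedding.inl) j.2⟩)
    (measurable_pi_lambda _ fun i => measurable_pi_apply _)
    (measurable_pi_lambda _ fun i => measurable_pi_apply _)

/-- The map `(x, z) ↦ (x, idleSeq x z)` is a skew product over the service times whose fibre maps
preserve `expSeq` for almost every `x`, so it preserves the product law. -/
lemma IsSystem.measurePreserving_idleSeq (h : IsSystem P lam Z X) (hlam : 0 < lam) :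
    MeasurePreserving
      (fun ω => ((fun i => X i ω), idleSeq (fun i => X i ω) (fun i => Z (i + 1) ω))) P
      ((P.map fun ω i => X i ω).prod (expSeq lam)) := by
  have := isProbabilityMeasure_expSeq hlam
  have hmX : Measurable fun ω i => X i ω := measurable_pi_lambda _ h.measurable_X
  have hmZ : Measurable fun ω i => Z (i + 1) ω :=
    measurable_pi_lambda _ fun i => h.measurable_Z (i + 1)
  have hnonneg : ∀ᵐ x ∂(P.map fun ω i => X i ω), ∀ i, 0 ≤ x i := by
    rw [ae_map_iff hmX.aemeasurable (by
      simp only [Set.ofPred_forall]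
      exact MeasurableSet.iInter fun i => measurableSet_le measurable_const (measurable_pi_apply i))]
    exact ae_all_iff.2 h.nonneg_X
  have h1 : MeasurePreserving (fun ω => ((fun i => X i ω), (fun i => Z (i + 1) ω))) P
      ((P.map fun ω i => X i ω).prod (expSeq lam)) := by
    refine ⟨hmX.prodMk hmZ, ?_⟩
    rw [← h.map_Z_succ]
    exact (indepFun_iff_map_prod_eq_prod_map_map hmX.aemeasurable hmZ.aemeasurable).1 h.indepFun_X_Z
  have := Measure.isProbabilityMeasure_map (μ := P) hmX.aemeasurable
  have h2 := (MeasurePreserving.id (P.map fun ω i => X i ω)).skew_product (g := idleSeq)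
    (μc := expSeq lam) measurable_idleSeq
    (hnonneg.mono fun x hx => map_idleSeq_expSeq hlam hx)
  exact h2.comp h1

lemma IsSystem.map_idleTime_succ (h : IsSystem P lam Z X) (hlam : 0 < lam) (k : ℕ) :
    P.map (idleTime Z X (k + 1)) = expMeasure lam := by
  have := isProbabilityMeasure_expMeasure hlam
  have hm := (measurePreserving_eval_infinitePi (fun _ : ℕ => expMeasure lam) k)
  have := isProbabilityMeasure_expSeq hlam
  have hmX : Measurable fun ω i => X i ω := measurable_pi_lambda _ h.measurable_X
  have := Measure.isProbabilityMeasure_map (μ := P) hmX.aemeasurable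
  have h2 := (hm.comp (measurePreserving_snd (μ := P.map fun ω i => X i ω)
    (ν := expSeq lam))).comp (h.measurePreserving_idleSeq hlam)
  rw [← h2.map_eq]
  refine Measure.map_congr ?_
  filter_upwards [h.ae_isRegularPath hlam] with ω hω
  exact hω.idleTime_succ k

/-- The service times and the idle times are jointly independent. -/
lemma IsSystem.iIndepFun_X_idleTime (h : IsSystem P lam Z X) (hlam : 0 < lam) :
    iIndepFun (Sum.elim X fun k => idleTime Z X (k + 1)) P := by
  have := isProbabilityMeasure_expSeq hlam
  have := isProbabilityMeasure_expMeasure hlam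
  have hmX : Measurable fun ω i => X i ω := measurable_pi_lambda _ h.measurable_X
  have hmZ : Measurable fun ω i => Z (i + 1) ω :=
    measurable_pi_lambda _ fun i => h.measurable_Z (i + 1)
  have := Measure.isProbabilityMeasure_map (μ := P) hmX.aemeasurable
  have hmp := h.measurePreserving_idleSeq hlam
  have hmI : Measurable fun ω => idleSeq (fun i => X i ω) (fun i => Z (i + 1) ω) :=
    measurable_snd.comp hmp.measurable
  have hmapI : P.map (fun ω => idleSeq (fun i => X i ω) (fun i => Z (i + 1) ω)) = expSeq lam :=
    ((measurePreserving_snd (μ := P.map fun ω i => X i ω) (ν := expSeq lam)).comp hmp).map_eq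
  have hmIk : ∀ k, Measurable fun ω => idleSeq (fun i => X i ω) (fun i => Z (i + 1) ω) k :=
    fun k => (measurable_pi_apply k).comp hmI
  have hae : ∀ i, Sum.elim X (fun k ω => idleSeq (fun i => X i ω) (fun i => Z (i + 1) ω) k) i
      =ᵐ[P] Sum.elim X (fun k => idleTime Z X (k + 1)) i := by
    rintro (i | k)
    · rfl
    · filter_upwards [h.ae_isRegularPath hlam] with ω hω
      exact (hω.idleTime_succ k).symm
  refine (iIndepFun_sumElim h.iIndepFun_X ?_ ?_).congr hae
  · rw [iIndepFun_iff_map_fun_eq_infinitePi_map hmIk]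
    refine hmapI.trans ?_
    unfold expSeq
    congr 1
    funext k
    rw [← h.map_idleTime_succ hlam k]
    exact (Measure.map_congr (hae (Sum.inr k))).symm
  · refine (indepFun_iff_map_prod_eq_prod_map_map hmX.aemeasurable hmI.aemeasurable).2 ?_
    rw [hmapI]
    exact hmp.map_eq

end Independence

/-! ### From limits along a subsequence of times to all times -/

section Sandwich

/-- For `D n ≤ T < D (n + 1)`, monotonicity traps `B T / T` between `B (D n) / D (n + 1)` and `B (D
(n + 1)) / D n`; both tend to `a / m` because `(n + 1) / n → 1`. -/
lemma tendsto_div_of_monotone_of_subseq {B : ℝ → ℝ} (hB : Monotone B) (hB0 : ∀ T, 0 ≤ B T)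
    {D : ℕ → ℝ} (hD : Monotone D) {a m : ℝ} (hm : 0 < m)
    (hBD : Tendsto (fun n : ℕ => B (D n) / n) atTop (𝓝 a))
    (hDn : Tendsto (fun n : ℕ => D n / n) atTop (𝓝 m)) :
    Tendsto (fun T => B T / T) atTop (𝓝 (a / m)) := by
  have hDtop : Tendsto D atTop atTop := by
    refine (hDn.pos_mul_atTop hm (tendsto_natCast_atTop_atTop (R := ℝ))).congr' ?_
    filter_upwards [eventually_ge_atTop 1] with n hn
    have : (n : ℝ) ≠ 0 := by positivity
    field_simp
  set N : ℝ → ℕ := fun T => sInf {n : ℕ | T < D (n + 1)} with hN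
  have hlt : ∀ T, T < D (N T + 1) := fun T => by
    have hne : {n : ℕ | T < D (n + 1)}.Nonempty :=
      (((tendsto_add_atTop_iff_nat 1).2 hDtop).eventually_gt_atTop T).exists
    exact Nat.sInf_mem hne
  -- When `N T = 0` minimality carries no information, so `D 0 ≤ T` has to be assumed.
  have hle : ∀ T, D 0 ≤ T → D (N T) ≤ T := fun T hT => by
    rcases h : N T with _ | n
    · exact hT
    · have : n ∉ {n : ℕ | T < D (n + 1)} := Nat.notMem_of_lt_sInf (by
        change n < N T
        omega)
      exact not_lt.1 this
  have hNtop : Tendsto N atTop atTop := by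
    refine tendsto_atTop.2 fun M => ?_
    filter_upwards [eventually_ge_atTop (D M)] with T hT
    by_contra! h
    exact absurd (hT.trans_lt (hlt T)) (not_lt.2 (hD h))
  have hsucc : Tendsto (fun n : ℕ => ((n + 1 : ℕ) : ℝ) / n) atTop (𝓝 1) := by
    have h := (tendsto_inv_atTop_nhds_zero_nat (𝕜 := ℝ)).const_add 1
    rw [add_zero] at h
    refine h.congr' ?_
    filter_upwards [eventually_ge_atTop 1] with n hn
    have : (n : ℝ) ≠ 0 := by positivity
    push_cast
    field_simp
  have hBD' := (tendsto_add_atTop_iff_nat 1).2 hBD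
  have hDn' := (tendsto_add_atTop_iff_nat 1).2 hDn
  have hup : Tendsto (fun n => B (D (n + 1)) / D n) atTop (𝓝 (a / m)) := by
    have h := (hBD'.mul hsucc).div hDn hm.ne'
    rw [mul_one] at h
    refine h.congr' ?_
    filter_upwards [eventually_ge_atTop 1] with n hn
    have h1 : (n : ℝ) ≠ 0 := by positivity
    have h2 : ((n + 1 : ℕ) : ℝ) ≠ 0 := by positivity
    simp only [Pi.div_apply]
    rw [div_mul_div_cancel₀ h2, div_div_div_cancel_right₀ h1]
  have hlo : Tendsto (fun n => B (D n) / D (n + 1)) atTop (𝓝 (a / m)) := by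
    have h := hBD.div (hDn'.mul hsucc) (by simpa using hm.ne')
    rw [mul_one] at h
    refine h.congr' ?_
    filter_upwards [eventually_ge_atTop 1] with n hn
    have h1 : (n : ℝ) ≠ 0 := by positivity
    have h2 : ((n + 1 : ℕ) : ℝ) ≠ 0 := by positivity
    simp only [Pi.div_apply]
    rw [div_mul_div_cancel₀ h2, div_div_div_cancel_right₀ h1]
  refine tendsto_of_tendsto_of_tendsto_of_le_of_le' (hlo.comp hNtop) (hup.comp hNtop) ?_ ?_
  · filter_upwards [eventually_ge_atTop (D 0), eventually_gt_atTop 0] with T hT hT0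
    exact div_le_div₀ (hB0 T) (hB (hle T hT)) hT0 (hlt T).le
  · filter_upwards [eventually_ge_atTop (D 0), hNtop.eventually (hDtop.eventually_gt_atTop 0)]
      with T hT hpos
    exact div_le_div₀ (hB0 _) (hB (hlt T).le) hpos (hle T hT)

end Sandwich

/-! ### Age and violation time between departures -/

section Paths

variable {Ω : Type*} {Z X : ℕ → Ω → ℝ} {ω : Ω}

lemma IsRegularPath.TA_le_TD (h : IsRegularPath Z X ω) (n : ℕ) : TA Z X n ω ≤ TD Z X n ω :=
  le_add_of_nonneg_right (h.nonneg_X n)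

lemma IsRegularPath.monotone_TA (h : IsRegularPath Z X ω) : Monotone fun n => TA Z X n ω :=
  monotone_nat_of_le_succ fun n => (h.TA_le_TD n).trans (h.TD_le_TA n)

lemma IsRegularPath.monotone_TD (h : IsRegularPath Z X ω) : Monotone fun n => TD Z X n ω :=
  monotone_nat_of_le_succ fun n => (h.TD_le_TA n).trans (h.TA_le_TD (n + 1))

lemma IsRegularPath.TD_nonneg (h : IsRegularPath Z X ω) (n : ℕ) : 0 ≤ TD Z X n ω := by
  have h0 : 0 ≤ TA Z X 0 ω := by
    simpa [TA, servedIndex, arrivalTime] using h.nonneg_Z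
  exact h0.trans ((h.TA_le_TD 0).trans (h.monotone_TD (Nat.zero_le n)))

lemma IsRegularPath.tendsto_TD (h : IsRegularPath Z X ω) :
    Tendsto (fun n => TD Z X n ω) atTop atTop := by
  have hmono : StrictMono fun n => servedIndex Z X n ω := strictMono_nat_of_lt_succ fun n =>
    (Nat.sInf_mem (h.exists_served n)).1
  exact tendsto_atTop_mono h.TA_le_TD (h.tendsto_arrivalTime.comp hmono.tendsto_atTop)

lemma IsRegularPath.age_eq (h : IsRegularPath Z X ω) {n : ℕ} {t : ℝ} (h1 : TD Z X n ω ≤ t)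
    (h2 : t < TD Z X (n + 1) ω) : age Z X t ω = t - TA Z X n ω := by
  have : IsGreatest {s : ℝ | ∃ n : ℕ, TD Z X n ω ≤ t ∧ s = TA Z X n ω} (TA Z X n ω) := by
    refine ⟨⟨n, h1, rfl⟩, ?_⟩
    rintro s ⟨m, hm, rfl⟩
    refine h.monotone_TA (Nat.lt_succ_iff.1 ?_)
    by_contra! hlt
    exact absurd (hm.trans_lt h2) (not_lt.2 (h.monotone_TD hlt))
  rw [age, this.csSup_eq]

lemma IsRegularPath.age_eq_self (h : IsRegularPath Z X ω) {t : ℝ} (ht : t < TD Z X 0 ω) :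
    age Z X t ω = t := by
  have : {s : ℝ | ∃ n : ℕ, TD Z X n ω ≤ t ∧ s = TA Z X n ω} = ∅ := by
    refine Set.eq_empty_of_forall_notMem ?_
    rintro s ⟨m, hm, -⟩
    exact absurd (hm.trans_lt ht) (not_lt.2 (h.monotone_TD (Nat.zero_le m)))
  rw [age, this, Real.sSup_empty, sub_zero]

/-- The time during `[0, T]` at which the age exceeds `d`. -/
noncomputable def violationTime (Z X : ℕ → Ω → ℝ) (d T : ℝ) (ω : Ω) : ℝ :=
  volume.real {τ : ℝ | 0 ≤ τ ∧ τ ≤ T ∧ d < age Z X τ ω}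

lemma violationTime_ne_top (Z X : ℕ → Ω → ℝ) (d T : ℝ) (ω : Ω) :
    volume {τ : ℝ | 0 ≤ τ ∧ τ ≤ T ∧ d < age Z X τ ω} ≠ ⊤ :=
  measure_ne_top_of_subset
    (show {τ : ℝ | 0 ≤ τ ∧ τ ≤ T ∧ d < age Z X τ ω} ⊆ Set.Icc 0 T from fun _ h => ⟨h.1, h.2.1⟩)
    measure_Icc_lt_top.ne

lemma monotone_violationTime (Z X : ℕ → Ω → ℝ) (d : ℝ) (ω : Ω) :
    Monotone fun T => violationTime Z X d T ω := fun _ T h =>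
  measureReal_mono (fun _ hτ => ⟨hτ.1, hτ.2.1.trans h, hτ.2.2⟩) (violationTime_ne_top Z X d T ω)

lemma violationTime_nonneg (Z X : ℕ → Ω → ℝ) (d T : ℝ) (ω : Ω) : 0 ≤ violationTime Z X d T ω :=
  measureReal_nonneg

lemma violationTime_le (Z X : ℕ → Ω → ℝ) (d : ℝ) {T : ℝ} (hT : 0 ≤ T) (ω : Ω) :
    violationTime Z X d T ω ≤ T := by
  have h := measureReal_mono (μ := volume) (s₂ := Set.Icc 0 T)
    (fun τ (h : τ ∈ {τ : ℝ | 0 ≤ τ ∧ τ ≤ T ∧ d < age Z X τ ω}) => ⟨h.1, h.2.1⟩) (by simp)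
  simpa [violationTime, hT] using h

/-- Between the two departures the age is `τ - TA n`, so up to a null set the violation lasts from
`max (TD n) (TA n + d)` to `TD (n + 1)`. -/
lemma IsRegularPath.violationTime_TD_succ (h : IsRegularPath Z X ω) (d : ℝ) (n : ℕ) :
    violationTime Z X d (TD Z X (n + 1) ω) ω =
      violationTime Z X d (TD Z X n ω) ω + g Z X d (n + 1) ω := by
  have hle := h.monotone_TD (Nat.le_succ n)
  simp only [Nat.succ_eq_add_one] at hle
  rw [violationTime, ← measureReal_inter_add_sdiff (measurableSet_Iic (a := TD Z X n ω))
    (violationTime_ne_top Z X d _ ω)]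
  congr 1
  · rw [violationTime]
    congr 1
    ext τ
    exact ⟨fun hτ => ⟨hτ.1.1, hτ.2, hτ.1.2.2⟩, fun hτ => ⟨⟨hτ.1, hτ.2.1.trans hle, hτ.2.2⟩, hτ.2.1⟩⟩
  · have hae : ({τ : ℝ | 0 ≤ τ ∧ τ ≤ TD Z X (n + 1) ω ∧ d < age Z X τ ω} \
        Set.Iic (TD Z X n ω) : Set ℝ) =ᵐ[volume]
        Set.Ioo (max (TD Z X n ω) (TA Z X n ω + d)) (TD Z X (n + 1) ω) := by
      -- At the right endpoint packet `n + 1` has already departed and the age formula no longer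
      -- applies; that single point is discarded.
      filter_upwards [compl_mem_ae_iff.2 (measure_singleton (μ := volume) (TD Z X (n + 1) ω))]
        with τ hτ
      refine propext ?_
      change ((0 ≤ τ ∧ τ ≤ TD Z X (n + 1) ω ∧ d < age Z X τ ω) ∧ ¬ τ ≤ TD Z X n ω) ↔
        (max (TD Z X n ω) (TA Z X n ω + d) < τ ∧ τ < TD Z X (n + 1) ω)
      rw [max_lt_iff, not_le]
      constructor
      · rintro ⟨⟨-, h2, h3⟩, h4⟩
        have h5 := lt_of_le_of_ne h2 hτ
        rw [h.age_eq h4.le h5] at h3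
        exact ⟨⟨h4, by linarith⟩, h5⟩
      · rintro ⟨⟨h1, h2⟩, h3⟩
        refine ⟨⟨(h.TD_nonneg n).trans h1.le, h3.le, ?_⟩, h1⟩
        rw [h.age_eq h1.le h3]
        linarith
    rw [measureReal_congr hae, Real.volume_real_Ioo, g, idleTime, Nat.add_sub_cancel]
    have e1 : X n ω + (TA Z X (n + 1) ω - TD Z X n ω) + X (n + 1) ω - d =
        TD Z X (n + 1) ω - (TA Z X n ω + d) := by
      simp only [TD]; ring
    have e2 : X (n + 1) ω + (TA Z X (n + 1) ω - TD Z X n ω) =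
        TD Z X (n + 1) ω - TD Z X n ω := by
      rw [show TD Z X (n + 1) ω = TA Z X (n + 1) ω + X (n + 1) ω from rfl]; ring
    -- The positive part distributes over the minimum and is superfluous on the interdeparture time,
    -- which is nonnegative.
    rw [e1, e2, ← min_sub_sub_left, max_min_distrib_right, max_eq_left (sub_nonneg.2 hle), min_comm]

lemma IsRegularPath.violationTime_TD (h : IsRegularPath Z X ω) (d : ℝ) (n : ℕ) :
    violationTime Z X d (TD Z X n ω) ω =
      violationTime Z X d (TD Z X 0 ω) ω + ∑ i ∈ Finset.range n, g Z X d (i + 1) ω := by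
  induction n with
  | zero => simp
  | succ n ih => rw [h.violationTime_TD_succ, ih, Finset.sum_range_succ, add_assoc]

lemma TD_sub_TD (Z X : ℕ → Ω → ℝ) (n : ℕ) (ω : Ω) :
    TD Z X (n + 1) ω - TD Z X n ω = idleTime Z X (n + 1) ω + X (n + 1) ω := by
  rw [idleTime, Nat.add_sub_cancel, TD]; ring

lemma TD_eq_sum (Z X : ℕ → Ω → ℝ) (n : ℕ) (ω : Ω) :
    TD Z X n ω = TD Z X 0 ω + (∑ i ∈ Finset.range n, idleTime Z X (i + 1) ω +
      ∑ i ∈ Finset.range n, X (i + 1) ω) := by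
  rw [← Finset.sum_add_distrib, ← Finset.sum_congr rfl fun i _ => TD_sub_TD Z X i ω,
    Finset.sum_range_sub fun i => TD Z X i ω]
  ring

end Paths

/-! ### Means, identical laws and the strong law for the violation fraction -/

section LawOfLargeNumbers

variable {Ω : Type*} [MeasurableSpace Ω] {P : Measure Ω} {lam mu : ℝ} {Z X : ℕ → Ω → ℝ}

lemma IsSystem.integrable_X (h : IsSystem P lam Z X) (hXint : Integrable (X 0) P) (k : ℕ) :
    Integrable (X k) P :=
  (h.identDistrib_X k).integrable_iff.2 hXint

lemma IsSystem.integral_X (h : IsSystem P lam Z X) (hXmean : ∫ ω, X 0 ω ∂P = 1 / mu) (k : ℕ) :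
    ∫ ω, X k ω ∂P = 1 / mu :=
  (h.identDistrib_X k).integral_eq.trans hXmean

variable [IsProbabilityMeasure P]

lemma IsSystem.iIndepFun_triple (h : IsSystem P lam Z X) (hlam : 0 < lam) (k : ℕ) :
    iIndepFun ![X k, idleTime Z X (k + 1), X (k + 1)] P := by
  have hinj : Function.Injective (![Sum.inl k, Sum.inr k, Sum.inl (k + 1)] : Fin 3 → ℕ ⊕ ℕ) := by
    intro i j hij
    fin_cases i <;> fin_cases j <;> simp at hij ⊢
  have h3 := (h.iIndepFun_X_idleTime hlam).precomp hinj
  have he : (fun i => Sum.elim X (fun k => idleTime Z X (k + 1))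
      ((![Sum.inl k, Sum.inr k, Sum.inl (k + 1)] : Fin 3 → ℕ ⊕ ℕ) i)) =
      ![X k, idleTime Z X (k + 1), X (k + 1)] := by
    funext i
    fin_cases i <;> rfl
  rw [← he]
  exact h3

lemma IsSystem.integrable_idleTime (h : IsSystem P lam Z X) (hlam : 0 < lam) (k : ℕ) :
    Integrable (idleTime Z X (k + 1)) P := by
  have h1 := integrable_id_expMeasure hlam
  rw [← h.map_idleTime_succ hlam k] at h1
  exact h1.comp_measurable (measurable_idleTime h.measurable_Z h.measurable_X _)

lemma IsSystem.integral_idleTime (h : IsSystem P lam Z X) (hlam : 0 < lam) (k : ℕ) :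
    ∫ ω, idleTime Z X (k + 1) ω ∂P = 1 / lam := by
  have h1 : ∫ y, y ∂(P.map (idleTime Z X (k + 1))) = ∫ ω, idleTime Z X (k + 1) ω ∂P :=
    integral_map (f := fun y : ℝ => y)
      (measurable_idleTime h.measurable_Z h.measurable_X _).aemeasurable
      measurable_id.aestronglyMeasurable
  rw [← h1, h.map_idleTime_succ hlam, integral_id_expMeasure hlam]

lemma IsSystem.integral_TD_sub_TD (h : IsSystem P lam Z X) (hlam : 0 < lam)
    (hXint : Integrable (X 0) P) (hXmean : ∫ ω, X 0 ω ∂P = 1 / mu) (k : ℕ) :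
    ∫ ω, (TD Z X (k + 1) ω - TD Z X k ω) ∂P = 1 / lam + 1 / mu := by
  simp only [TD_sub_TD]
  rw [integral_add (h.integrable_idleTime hlam k) (h.integrable_X hXint (k + 1)),
    h.integral_idleTime hlam, h.integral_X hXmean]

lemma measurable_g (hZ : ∀ n, Measurable (Z n)) (hX : ∀ n, Measurable (X n)) (d : ℝ) (k : ℕ) :
    Measurable (g Z X d k) :=
  ((((((hX (k - 1)).add (measurable_idleTime hZ hX k)).add (hX k)).sub_const d).max
    measurable_const).min ((hX k).add (measurable_idleTime hZ hX k)))

lemma IsSystem.integrable_g (h : IsSystem P lam Z X) (hlam : 0 < lam)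
    (hXint : Integrable (X 0) P) (d : ℝ) (k : ℕ) : Integrable (g Z X d (k + 1)) P := by
  refine Integrable.mono ((h.integrable_X hXint (k + 1)).add (h.integrable_idleTime hlam k))
    (measurable_g h.measurable_Z h.measurable_X d (k + 1)).aestronglyMeasurable
    (ae_of_all _ fun ω => ?_)
  rw [Real.norm_eq_abs, Real.norm_eq_abs, Pi.add_apply, g, abs_le]
  have h1 := neg_abs_le (X (k + 1) ω + idleTime Z X (k + 1) ω)
  have h2 := le_abs_self (X (k + 1) ω + idleTime Z X (k + 1) ω)
  have h3 := abs_nonneg (X (k + 1) ω + idleTime Z X (k + 1) ω)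
  exact ⟨le_min (le_max_of_le_right (by linarith)) h1, (min_le_right _ _).trans h2⟩

/-- `g` as a function of two consecutive service times and the idle time between them. -/
noncomputable def ageExcess (d : ℝ) (v : Fin 3 → ℝ) : ℝ :=
  min (max (v 0 + v 1 + v 2 - d) 0) (v 2 + v 1)

lemma measurable_ageExcess (d : ℝ) : Measurable (ageExcess d) := by
  have h : ∀ i : Fin 3, Measurable fun v : Fin 3 → ℝ => v i := measurable_pi_apply
  exact (((((h 0).add (h 1)).add (h 2)).sub_const d).max measurable_const).min ((h 2).add (h 1))

lemma IsSystem.identDistrib_idleTime (h : IsSystem P lam Z X) (hlam : 0 < lam) (k l : ℕ) :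
    IdentDistrib (idleTime Z X (k + 1)) (idleTime Z X (l + 1)) P P :=
  ⟨(measurable_idleTime h.measurable_Z h.measurable_X _).aemeasurable,
    (measurable_idleTime h.measurable_Z h.measurable_X _).aemeasurable,
    (h.map_idleTime_succ hlam k).trans (h.map_idleTime_succ hlam l).symm⟩

lemma IsSystem.identDistrib_g (h : IsSystem P lam Z X) (hlam : 0 < lam) (d : ℝ) (k l : ℕ) :
    IdentDistrib (g Z X d (k + 1)) (g Z X d (l + 1)) P P := by
  have hX : ∀ i j, IdentDistrib (X i) (X j) P P := fun i j =>
    (h.identDistrib_X i).trans (h.identDistrib_X j).symm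
  have h3 : IdentDistrib (fun ω i => (![X k, idleTime Z X (k + 1), X (k + 1)] : Fin 3 → Ω → ℝ) i ω)
      (fun ω i => (![X l, idleTime Z X (l + 1), X (l + 1)] : Fin 3 → Ω → ℝ) i ω) P P := by
    refine IdentDistrib.pi (fun i => ?_) (h.iIndepFun_triple hlam k) (h.iIndepFun_triple hlam l)
    fin_cases i
    · exact hX k l
    · exact h.identDistrib_idleTime hlam k l
    · exact hX (k + 1) (l + 1)
  exact h3.comp (measurable_ageExcess d)

/-- Consecutive values of `g` share a service time; at distance two or more they depend on disjoint
sets of independent variables. -/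
lemma IsSystem.indepFun_g (h : IsSystem P lam Z X) (hlam : 0 < lam) (d : ℝ) {k l : ℕ}
    (hkl : k + 2 ≤ l ∨ l + 2 ≤ k) : IndepFun (g Z X d (k + 1)) (g Z X d (l + 1)) P := by
  classical
  let S : ℕ → Finset (ℕ ⊕ ℕ) := fun k => {Sum.inl k, Sum.inr k, Sum.inl (k + 1)}
  have hd : Disjoint (S k) (S l) := by
    rw [Finset.disjoint_left]
    intro a ha hb
    simp only [S, Finset.mem_insert, Finset.mem_singleton] at ha hb
    rcases ha with rfl | rfl | rfl <;> simp at hb <;> omega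
  have hm : ∀ i, Measurable (Sum.elim X (fun k => idleTime Z X (k + 1)) i) := by
    rintro (i | i)
    exacts [h.measurable_X i, measurable_idleTime h.measurable_Z h.measurable_X _]
  have hind := (h.iIndepFun_X_idleTime hlam).indepFun_finset _ _ hd hm
  let φ : ∀ k, (S k → ℝ) → ℝ := fun k x => ageExcess d
    ![x ⟨Sum.inl k, by simp [S]⟩, x ⟨Sum.inr k, by simp [S]⟩, x ⟨Sum.inl (k + 1), by simp [S]⟩]
  have hφ : ∀ k, Measurable (φ k) := fun k => by
    refine (measurable_ageExcess d).comp (measurable_pi_lambda _ fun i => ?_)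
    fin_cases i <;> exact measurable_pi_apply _
  exact hind.comp (φ := φ k) (ψ := φ l) (hφ k) (hφ l)

lemma sum_range_two_mul (u : ℕ → ℝ) (n : ℕ) :
    ∑ i ∈ Finset.range (2 * n), u i =
      ∑ i ∈ Finset.range n, u (2 * i) + ∑ i ∈ Finset.range n, u (2 * i + 1) := by
  induction n with
  | zero => simp
  | succ n ih =>
    rw [mul_add, mul_one, Finset.sum_range_succ, Finset.sum_range_succ, ih,
      Finset.sum_range_succ _ n, Finset.sum_range_succ _ n]
    ring

/-- The strong law needs pairwise independence, which `g` has only within even or within odd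
indices. The two averages are added along the departures `2 * n`, and the resulting factors `2`
cancel in the ratio. -/
lemma IsSystem.ae_tendsto_violationTime_div (h : IsSystem P lam Z X) (hlam : 0 < lam)
    (hmu : 0 < mu) (hXint : Integrable (X 0) P) (hXmean : ∫ ω, X 0 ω ∂P = 1 / mu) (d : ℝ)
    (k : ℕ) :
    ∀ᵐ ω ∂P, Tendsto (fun T => violationTime Z X d T ω / T) atTop
      (𝓝 ((∫ ω', g Z X d (k + 1) ω' ∂P) / (1 / lam + 1 / mu))) := by
  have hg : ∀ j, ∫ ω, g Z X d (j + 1) ω ∂P = ∫ ω, g Z X d (k + 1) ω ∂P := fun j =>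
    (h.identDistrib_g hlam d j k).integral_eq
  have heven := strong_law_ae_real (fun j => g Z X d (2 * j + 1)) (h.integrable_g hlam hXint d 0)
    (fun i j hij => h.indepFun_g hlam d (by omega)) (fun j => h.identDistrib_g hlam d (2 * j) 0)
  have hodd := strong_law_ae_real (fun j => g Z X d (2 * j + 1 + 1))
    (h.integrable_g hlam hXint d 1)
    (fun i j hij => h.indepFun_g hlam d (by omega)) (fun j => h.identDistrib_g hlam d (2 * j + 1) 1)
  have hI := strong_law_ae_real (fun j => idleTime Z X (j + 1)) (h.integrable_idleTime hlam 0)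
    (fun i j hij => (h.iIndepFun_X_idleTime hlam).indepFun
      (i := Sum.inr i) (j := Sum.inr j) (by simpa using hij))
    (fun j => h.identDistrib_idleTime hlam j 0)
  have hX := strong_law_ae_real (fun j => X (j + 1)) (h.integrable_X hXint 1)
    (fun i j hij => h.iIndepFun_X.indepFun (by simpa using hij))
    (fun j => (h.identDistrib_X (j + 1)).trans (h.identDistrib_X 1).symm)
  filter_upwards [heven, hodd, hI, hX, h.ae_isRegularPath hlam] with ω he ho hI hX hreg
  have e0 : ∫ ω, g Z X d (2 * 0 + 1) ω ∂P = ∫ ω, g Z X d (k + 1) ω ∂P := hg 0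
  have e1 : ∫ ω, g Z X d (2 * 0 + 1 + 1) ω ∂P = ∫ ω, g Z X d (k + 1) ω ∂P := hg 1
  rw [e0] at he
  rw [e1] at ho
  rw [h.integral_idleTime hlam] at hI
  rw [h.integral_X hXmean] at hX
  have hconst : ∀ c : ℝ, Tendsto (fun n : ℕ => c / n) atTop (𝓝 0) :=
    fun c => tendsto_const_div_atTop_nhds_zero_nat c
  have hlim := tendsto_div_of_monotone_of_subseq (B := fun T => violationTime Z X d T ω)
    (D := fun n => TD Z X (2 * n) ω) (m := 2 * (1 / lam + 1 / mu))
    (a := 2 * ∫ ω', g Z X d (k + 1) ω' ∂P)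
    (monotone_violationTime Z X d ω) (fun T => violationTime_nonneg Z X d T ω)
    (fun i j hij => hreg.monotone_TD (Nat.mul_le_mul_left 2 hij)) (by positivity) ?_ ?_
  · rwa [mul_div_mul_left _ _ two_ne_zero] at hlim
  · have := (hconst (violationTime Z X d (TD Z X 0 ω) ω)).add (he.add ho)
    rw [zero_add, ← two_mul] at this
    refine this.congr fun n => ?_
    rw [hreg.violationTime_TD d (2 * n), sum_range_two_mul]
    ring
  · have h2 : Tendsto (fun n : ℕ => 2 * n) atTop atTop :=
      tendsto_id.const_mul_atTop' two_pos
    have := (((hconst (TD Z X 0 ω)).add (hI.add hX)).comp h2).const_mul 2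
    rw [zero_add] at this
    refine this.congr fun n => ?_
    simp only [Function.comp_apply]
    rw [TD_eq_sum Z X (2 * n)]
    rcases eq_or_ne (n : ℝ) 0 with hn | hn
    · simp [hn]
    · push_cast
      field_simp

end LawOfLargeNumbers

/-! ### Identification of the limiting violation probability -/

section ViolationProbability

variable {Ω : Type*} {Z X : ℕ → Ω → ℝ}

/-- The pairs of a time `τ` and an outcome `ω` for which the age exceeds `d`, described through the
departure immediately before `τ`. It is measurable, and its section at every regular path
is the set of all times at which the age exceeds `d`. -/
def violationSet (Z X : ℕ → Ω → ℝ) (d : ℝ) : Set (ℝ × Ω) :=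
  {q | q.1 < TD Z X 0 q.2 ∧ d < q.1} ∪
    ⋃ n, {q | (TD Z X n q.2 ≤ q.1 ∧ q.1 < TD Z X (n + 1) q.2) ∧ d < q.1 - TA Z X n q.2}

lemma IsRegularPath.mem_violationSet_iff {ω : Ω} (h : IsRegularPath Z X ω) (d τ : ℝ) :
    (τ, ω) ∈ violationSet Z X d ↔ d < age Z X τ ω := by
  have hmem : (τ, ω) ∈ violationSet Z X d ↔ (τ < TD Z X 0 ω ∧ d < τ) ∨
      ∃ n, (TD Z X n ω ≤ τ ∧ τ < TD Z X (n + 1) ω) ∧ d < τ - TA Z X n ω := by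
    simp [violationSet]
  rw [hmem]
  constructor
  · rintro (⟨h1, h2⟩ | ⟨n, ⟨h1, h2⟩, h3⟩)
    · rwa [h.age_eq_self h1]
    · rwa [h.age_eq h1 h2]
  · intro hd
    by_cases h0 : τ < TD Z X 0 ω
    · exact Or.inl ⟨h0, by rwa [h.age_eq_self h0] at hd⟩
    · right
      have hex : ∃ n, τ < TD Z X n ω := (h.tendsto_TD.eventually_gt_atTop τ).exists
      classical
      obtain ⟨n, hn⟩ : ∃ n, Nat.find hex = n + 1 :=
        Nat.exists_eq_succ_of_ne_zero fun he => h0 (he ▸ Nat.find_spec hex)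
      have h1 : TD Z X n ω ≤ τ := not_lt.1 (Nat.find_min hex (hn ▸ Nat.lt_succ_self n))
      have h2 : τ < TD Z X (n + 1) ω := hn ▸ Nat.find_spec hex
      exact ⟨n, ⟨h1, h2⟩, by rwa [h.age_eq h1 h2] at hd⟩

variable [MeasurableSpace Ω]

lemma measurableSet_violationSet (hZ : ∀ n, Measurable (Z n)) (hX : ∀ n, Measurable (X n))
    (d : ℝ) : MeasurableSet (violationSet Z X d) := by
  have hA : ∀ n, Measurable fun q : ℝ × Ω => TA Z X n q.2 :=
    fun n => (measurable_TA hZ hX n).comp measurable_snd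
  have hD : ∀ n, Measurable fun q : ℝ × Ω => TD Z X n q.2 :=
    fun n => (measurable_TD hZ hX n).comp measurable_snd
  exact ((measurableSet_lt measurable_fst (hD 0)).inter
    (measurableSet_lt measurable_const measurable_fst)).union
    (MeasurableSet.iUnion fun n => ((measurableSet_le (hD n) measurable_fst).inter
      (measurableSet_lt measurable_fst (hD (n + 1)))).inter
      (measurableSet_lt measurable_const (measurable_fst.sub (hA n))))

variable {P : Measure Ω} {lam : ℝ}

lemma IsSystem.measure_age_gt (h : IsSystem P lam Z X) (hlam : 0 < lam) (d τ : ℝ) :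
    P {ω | d < age Z X τ ω} = P (Prod.mk τ ⁻¹' violationSet Z X d) := by
  refine measure_congr ?_
  filter_upwards [h.ae_isRegularPath hlam] with ω hω
  exact propext (hω.mem_violationSet_iff d τ).symm

lemma IsSystem.violationTime_ae_eq (h : IsSystem P lam Z X) (hlam : 0 < lam) (d T : ℝ) :
    (fun ω => violationTime Z X d T ω) =ᵐ[P] fun ω =>
      ((volume.restrict (Set.Icc 0 T)) ((fun τ => (τ, ω)) ⁻¹' violationSet Z X d)).toReal := by
  filter_upwards [h.ae_isRegularPath hlam] with ω hω
  have hm : MeasurableSet ((fun τ => (τ, ω)) ⁻¹' violationSet Z X d) :=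
    measurable_prodMk_right (measurableSet_violationSet h.measurable_Z h.measurable_X d)
  rw [violationTime, measureReal_def, Measure.restrict_apply hm]
  congr 2
  ext τ
  change (0 ≤ τ ∧ τ ≤ T ∧ d < age Z X τ ω) ↔ ((τ, ω) ∈ violationSet Z X d ∧ 0 ≤ τ ∧ τ ≤ T)
  rw [hω.mem_violationSet_iff]
  tauto

lemma IsSystem.aestronglyMeasurable_violationTime (h : IsSystem P lam Z X) (hlam : 0 < lam)
    (d T : ℝ) : AEStronglyMeasurable (violationTime Z X d T) P :=
  (measurable_measure_prodMk_right (μ := volume.restrict (Set.Icc 0 T))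
    (measurableSet_violationSet h.measurable_Z h.measurable_X
      d)).ennreal_toReal.aestronglyMeasurable.congr (h.violationTime_ae_eq hlam d T).symm

variable [IsProbabilityMeasure P]

lemma IsSystem.measurable_measureReal_age_gt (h : IsSystem P lam Z X) (hlam : 0 < lam) (d : ℝ) :
    Measurable fun τ => P.real {ω | d < age Z X τ ω} := by
  simp only [measureReal_def, h.measure_age_gt hlam]
  exact (measurable_measure_prodMk_left
    (measurableSet_violationSet h.measurable_Z h.measurable_X d)).ennreal_toReal

/-- Fubini for `violationSet`, a measurable substitute for the event that the age exceeds `d`, with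
which it agrees on regular paths. -/
lemma IsSystem.integral_violationTime (h : IsSystem P lam Z X) (hlam : 0 < lam) (d : ℝ) {T : ℝ}
    (hT : 0 ≤ T) :
    ∫ ω, violationTime Z X d T ω ∂P = ∫ τ in (0 : ℝ)..T, P.real {ω | d < age Z X τ ω} := by
  have hm := measurableSet_violationSet h.measurable_Z h.measurable_X d
  rw [integral_congr_ae (h.violationTime_ae_eq hlam d T), intervalIntegral.integral_of_le hT,
    ← integral_Icc_eq_integral_Ioc]
  simp only [measureReal_def, h.measure_age_gt hlam]
  rw [integral_toReal (measurable_measure_prodMk_right hm).aemeasurable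
      (ae_of_all _ fun ω => measure_lt_top _ _),
    integral_toReal (measurable_measure_prodMk_left hm).aemeasurable
      (ae_of_all _ fun τ => measure_lt_top _ _),
    ← Measure.prod_apply hm, ← Measure.prod_apply_symm hm]

/-- A Cesàro argument: the substitution `τ = n * s` turns the time average into an integral of `f (n
* s)` over `[0, 1]`, to which dominated convergence applies. -/
lemma IsSystem.tendsto_integral_violationTime_div (h : IsSystem P lam Z X) (hlam : 0 < lam)
    {d p : ℝ} (hp : Tendsto (fun t : ℝ => P.real {ω | d < age Z X t ω}) atTop (𝓝 p)) :
    Tendsto (fun n : ℕ => ∫ ω, violationTime Z X d n ω / n ∂P) atTop (𝓝 p) := by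
  set f : ℝ → ℝ := fun t => P.real {ω | d < age Z X t ω} with hf
  have hfm : Measurable f := h.measurable_measureReal_age_gt hlam d
  have hlim : Tendsto (fun n : ℕ => ∫ s in (0 : ℝ)..1, f (n * s)) atTop
      (𝓝 (∫ _ in (0 : ℝ)..1, p)) := by
    refine intervalIntegral.tendsto_integral_filter_of_dominated_convergence (fun _ => 1)
      (Eventually.of_forall fun n => (hfm.comp (measurable_const_mul _)).aestronglyMeasurable)
      (Eventually.of_forall fun n => ae_of_all _ fun s _ => ?_) intervalIntegrable_const
      (ae_of_all _ fun s hs => ?_)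
    · rw [Real.norm_of_nonneg measureReal_nonneg]
      exact measureReal_le_one
    -- The half-open interval excludes `s = 0`, where `n * s` would not tend to infinity.
    · rw [Set.uIoc_of_le zero_le_one] at hs
      exact hp.comp (Tendsto.atTop_mul_const hs.1 (tendsto_natCast_atTop_atTop (R := ℝ)))
  rw [intervalIntegral.integral_const, sub_zero, one_smul] at hlim
  refine hlim.congr' ?_
  filter_upwards [eventually_ge_atTop 1] with n hn
  have hn0 : (n : ℝ) ≠ 0 := by positivity
  rw [intervalIntegral.integral_comp_mul_left f hn0, integral_div,
    h.integral_violationTime hlam d n.cast_nonneg, mul_zero, mul_one, smul_eq_mul,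
    inv_mul_eq_div]

/-- The expected violation fraction tends to `p` by the Cesàro limit and to `c` by dominated
convergence, the fraction being at most one. -/
lemma IsSystem.violationProbability_eq (h : IsSystem P lam Z X) (hlam : 0 < lam)
    {d p c : ℝ} (hp : Tendsto (fun t : ℝ => P.real {ω | d < age Z X t ω}) atTop (𝓝 p))
    (hc : ∀ᵐ ω ∂P, Tendsto (fun T => violationTime Z X d T ω / T) atTop (𝓝 c)) : p = c := by
  have h1 := h.tendsto_integral_violationTime_div hlam hp
  have h2 : Tendsto (fun n : ℕ => ∫ ω, violationTime Z X d n ω / n ∂P) atTop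
      (𝓝 (∫ _, c ∂P)) := by
    refine tendsto_integral_of_dominated_convergence (fun _ => 1)
      (fun n => by
        simpa only [div_eq_mul_inv] using
          (h.aestronglyMeasurable_violationTime hlam d n).mul_const (n : ℝ)⁻¹)
      (integrable_const _) (fun n => ae_of_all _ fun ω => ?_) ?_
    · rw [Real.norm_of_nonneg (div_nonneg (violationTime_nonneg _ _ _ _ _) n.cast_nonneg)]
      exact div_le_one_of_le₀ (violationTime_le Z X d n.cast_nonneg ω) n.cast_nonneg
    · filter_upwards [hc] with ω hω
      exact hω.comp (tendsto_natCast_atTop_atTop (R := ℝ))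
  rw [integral_const, probReal_univ, one_smul] at h2
  exact tendsto_nhds_unique h1 h2

end ViolationProbability

end MGI11

theorem theorem6 {Ω : Type*} [MeasurableSpace Ω] (P : Measure Ω) [IsProbabilityMeasure P]
    (lam mu : ℝ) (hlam : 0 < lam) (hmu : 0 < mu) (Z X : ℕ → Ω → ℝ)
    (hsys : MGI11.IsSystem P lam Z X)
    (hXint : Integrable (X 0) P) (hXmean : ∫ ω, X 0 ω ∂P = 1 / mu)
    (d : ℝ) (hd : 0 ≤ d) (k : ℕ) (hk : 1 ≤ k) :
    -- the idle time is exponential, and independent of the two service times in `g(k)`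
    P.map (MGI11.idleTime Z X k) = expMeasure lam ∧
    iIndepFun ![X (k - 1), MGI11.idleTime Z X k, X k] P ∧
    -- the departure rate
    1 / MGI11.departureRate P Z X k = 1 / lam + 1 / mu ∧
    -- the violation probability, if it exists
    Integrable (MGI11.g Z X d k) P ∧
    (∀ p : ℝ, Tendsto (fun t : ℝ => P.real {ω | d < MGI11.age Z X t ω}) atTop (𝓝 p) →
      p = MGI11.departureRate P Z X k * ∫ ω, MGI11.g Z X d k ω ∂P) ∧
    -- the fraction of time during which the age exceeds `d`, on almost every sample path
    (∀ᵐ ω ∂P, Tendsto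
      (fun T : ℝ => volume.real {τ : ℝ | 0 ≤ τ ∧ τ ≤ T ∧ d < MGI11.age Z X τ ω} / T) atTop
      (𝓝 (MGI11.departureRate P Z X k * ∫ ω', MGI11.g Z X d k ω' ∂P))) := by

  -- Reindexing removes the truncated subtraction `k - 1`.
  obtain ⟨k, rfl⟩ : ∃ j, k = j + 1 := ⟨k - 1, by omega⟩
  have hmean := hsys.integral_TD_sub_TD hlam hXint hXmean k
  have hrate : MGI11.departureRate P Z X (k + 1) = 1 / (1 / lam + 1 / mu) := by
    rw [MGI11.departureRate, Nat.add_sub_cancel, hmean]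
  have hlim := hsys.ae_tendsto_violationTime_div hlam hmu hXint hXmean d k
  have hc : MGI11.departureRate P Z X (k + 1) * ∫ ω, MGI11.g Z X d (k + 1) ω ∂P =
      (∫ ω, MGI11.g Z X d (k + 1) ω ∂P) / (1 / lam + 1 / mu) := by
    rw [hrate, one_div_mul_eq_div]
  rw [hc]
  refine ⟨hsys.map_idleTime_succ hlam k, hsys.iIndepFun_triple hlam k, ?_,
    hsys.integrable_g hlam hXint d k, fun p hp => hsys.violationProbability_eq hlam hp hlim, hlim⟩
  rw [hrate, one_div_one_div]
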